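/- Let $p$ be a prime and let $k$ be a finite field of characteristic $p$, with ring of $p$-typical Witt vectors $W(k)$. A \emph{frame} $\underline S=(S,\sigma,\tau)$ consists of a $\mathbb Z$-graded commutative ring $S=\bigoplus_{n\in\mathbb Z}S_n$ and ring homomorphisms $\sigma,\tau:S\to S_0$ such that: $\tau|_{S_0}=\mathrm{id}$ and $\tau:S_{-n}\to S_0$ is bijective for all $n\ge 1$; $\sigma|_{S_0}$ is a Frobenius lift (i.e. $\sigma(a)\equiv a^p$ modulo $pS_0$ for $a\in S_0$) and $\sigma(t)=p$, where $t\in S_{-1}$ is the unique element with $\tau(t)=1$; and $p$ lies in the Jacobson radical of $S_0$. It is a \emph{frame over $W(k)$} if $S$ is a graded $W(k)$-algebra and $\sigma$ extends the Frobenius of $W(k)$. Let $(G,\mu)$ be a \emph{display datum}, i.e. $G=\operatorname{Spec}A'$ is a smooth affine group scheme (of finite type) over $\mathbb Z_p$ and $\mu:\mathbb G_m\to G_{W(k)}$ is a cocharacter over $W(k)$. Put $A=W(k)\otimes_{\mathbb Z_p}A'$, so that $G_{W(k)}=\operatorname{Spec}A$. The action $g*\lambda=\mu(\lambda)^{-1}g\mu(\lambda)$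 of $\mathbb G_m$ on $G_{W(k)}$ defines a grading $A=\bigoplus_{n\in\mathbb Z}A_n$, where $A_n$ consists of the $f\in A$ with $f(g*\lambda)=\lambda^nf(g)$. Let $P^-\subseteq G_{W(k)}$ and $P^+\subseteq G_{W(k)}$ be the closed subgroup schemes defined by the ideals $(A_{>0})$ and $(A_{<0})$ generated by the elements of positive, respectively negative, degree. Let $L=P^+\cap P^-$; its coordinate ring is the degree zero part of $A/(A_{<0})$, and the inclusion of this degree zero part defines a homomorphism $P^+\to L$. Let $U^+$ be its kernel. For a graded $W(k)$-algebra $S$ let $G(S)_\mu\subseteq G_{W(k)}(S)$ be the group of $\mathbb G_m$-equivariant $S$-points, i.e. of homomorphisms of graded $W(k)$-algebras $A\to S$, and for a $\mathbb G_m$-stable closed subgroup scheme $H\subseteq G_{W(k)}$ let $H(S)_\mu=H(S)\cap G(S)_\mu$. Then for every display datum $(G,\mu)$ and every frame $\underline S=(S,\sigma,\tau)$ over $W(k)$, the multiplication map $$P^-(S)_\mu\times U^+(S)_\mu\to G(S)_\mu,\qquad (q,h)\mapsto qh,$$ is bijective. -/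

import Mathlib

open scoped TensorProduct LaurentPolynomial

noncomputable section

namespace GDisplay

/-! ### The `ℤ_p`-algebra `W(k)` -/

/-- For a ring `k` of characteristic `p`, the ring `W(k)` is a `ℤ_p`-algebra via
`ℤ_p ≅ W(𝔽_p) → W(k)`. -/
instance wittAlgebra (p : ℕ) [Fact p.Prime] (k : Type*) [CommRing k] [CharP k p] :
    Algebra ℤ_[p] (WittVector p k) :=
  ((WittVector.map (ZMod.castHom (dvd_refl p) k)).comp
    (WittVector.equiv p).symm.toRingHom).toAlgebra

/-! ### Frames -/

section Frame

variable {S E : Type*} [CommRing S] [SetLike E S] [AddSubgroupClass E S]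

/-- A pre-frame structure on a `ℤ`-graded ring `S = ⨁ Sₙ`: ring homomorphisms
`σ, τ : S → S₀`. -/
structure PreFrame (𝒮 : ℤ → E) [GradedRing 𝒮] where
  σ : S →+* 𝒮 0
  τ : S →+* 𝒮 0

/-- The axioms for a pre-frame to be a (higher) frame with respect to the prime `p`. -/
structure PreFrame.IsFrame (p : ℕ) {𝒮 : ℤ → E} [GradedRing 𝒮] (F : PreFrame 𝒮) : Prop where
  /-- `τ₀` is the identity of `S₀`. -/
  τ_zero : ∀ a : 𝒮 0, F.τ (a : S) = a
  /-- `τ₋ₙ : S₋ₙ → S₀` is bijective for `n ≥ 1`. -/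
  τ_neg_bijective : ∀ n : ℕ, 1 ≤ n →
    Function.Bijective (fun a : 𝒮 (-(n : ℤ)) => F.τ (a : S))
  /-- `σ₀` is a Frobenius lift: `σ₀(a) ≡ a ^ p` modulo `p S₀`. -/
  σ_frobenius : ∀ a : 𝒮 0, F.σ (a : S) - a ^ p ∈ Ideal.span {(p : 𝒮 0)}
  /-- The (unique) element `t ∈ S₋₁` with `τ(t) = 1` satisfies `σ(t) = p`. -/
  σ_t : ∃ t : 𝒮 (-1), F.τ (t : S) = 1 ∧ F.σ (t : S) = p
  /-- `p` lies in the Jacobson radical of `S₀`. -/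
  p_mem_rad : (p : 𝒮 0) ∈ Ideal.jacobson (⊥ : Ideal (𝒮 0))

end Frame

/-- A frame over `W(k)`: a frame whose underlying graded ring is a graded `W(k)`-algebra, such
that `σ` extends the Frobenius of `W(k)`. -/
structure PreFrame.IsFrameOverWitt (p : ℕ) [Fact p.Prime] {k : Type*} [CommRing k] [CharP k p]
    {S : Type*} [CommRing S] [Algebra (WittVector p k) S]
    {𝒮 : ℤ → Submodule (WittVector p k) S} [GradedAlgebra 𝒮] (F : PreFrame 𝒮) : Prop
    extends F.IsFrame p where
  σ_algebraMap : ∀ w : WittVector p k,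
    (F.σ (algebraMap (WittVector p k) S w) : S) =
      algebraMap (WittVector p k) S (WittVector.frobenius w)

/-! ### Weights for the conjugation action of a cocharacter

Here `G = Spec A` is an affine group scheme over a ring `W`, and a cocharacter `μ : 𝔾ₘ → G` is
given by the corresponding homomorphism of bialgebras `A → W[T, T⁻¹]`. -/

section Weights

variable {W : Type*} [CommRing W] {A : Type*} [CommRing A] [HopfAlgebra W A]

/-- The coaction `A → A ⊗ W[T, T⁻¹]` of the right action `(g, λ) ↦ μ(λ)⁻¹ g μ(λ)` of `𝔾ₘ` on
`G = Spec A`. It is the product `μ(T)⁻¹ · g · μ(T)` in `G(A ⊗ W[T, T⁻¹])`, where `g` denotes the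
universal point of `G`; the convolution product on `WithConv (A →ₐ[W] B)` is the group law
of `G(B)`, and inversion in `G` is given by the antipode. -/
def conjCoaction (μ : A →ₐc[W] W[T;T⁻¹]) : A →ₐ[W] A ⊗[W] W[T;T⁻¹] :=
  let m : A →ₐ[W] A ⊗[W] W[T;T⁻¹] :=
    (Algebra.TensorProduct.includeRight : W[T;T⁻¹] →ₐ[W] A ⊗[W] W[T;T⁻¹]).comp
      (μ : A →ₐ[W] W[T;T⁻¹])
  let g : A →ₐ[W] A ⊗[W] W[T;T⁻¹] := Algebra.TensorProduct.includeLeft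
  (WithConv.toConv (m.comp (HopfAlgebra.antipodeAlgHom W A)) * WithConv.toConv g *
    WithConv.toConv m).ofConv

/-- The weight space `Aₙ`: all `f ∈ A` with `f(μ(λ)⁻¹ g μ(λ)) = λⁿ f(g)`. -/
def weightSpace (μ : A →ₐc[W] W[T;T⁻¹]) (n : ℤ) : Submodule W A where
  carrier := {f | conjCoaction μ f = f ⊗ₜ[W] LaurentPolynomial.T n}
  add_mem' := by
    intro a b ha hb
    simp only [Set.mem_ofPred_eq] at *
    rw [map_add, ha, hb, TensorProduct.add_tmul]
  zero_mem' := by simp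
  smul_mem' := by
    intro c a ha
    simp only [Set.mem_ofPred_eq] at *
    rw [map_smul, ha, TensorProduct.smul_tmul']

/-- The ideal `(A_{>0})` defining the subgroup scheme `P⁻ ⊆ G`. -/
def idealPMinus (μ : A →ₐc[W] W[T;T⁻¹]) : Ideal A :=
  Ideal.span {f | ∃ n : ℤ, 0 < n ∧ f ∈ weightSpace μ n}

/-- The ideal `(A_{<0})` defining the subgroup scheme `P⁺ ⊆ G`. -/
def idealPPlus (μ : A →ₐc[W] W[T;T⁻¹]) : Ideal A :=
  Ideal.span {f | ∃ n : ℤ, n < 0 ∧ f ∈ weightSpace μ n}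

/-- The ideal defining `U⁺ = Ker(P⁺ → L)`. The coordinate ring of `L` is the degree zero part of
`A⁺ = A / (A_{<0})`, which is the image of `A₀`, and `P⁺ → L` is given by the inclusion
`(A⁺)₀ → A⁺`. Hence the kernel is cut out in `P⁺` by the elements `f - ε(f)` with `f ∈ A₀`,
where `ε` is the counit. -/
def idealUPlus (μ : A →ₐc[W] W[T;T⁻¹]) : Ideal A :=
  idealPPlus μ ⊔ Ideal.span
    {f | ∃ a ∈ weightSpace μ 0, f = a - algebraMap W A (Coalgebra.counit (R := W) a)}

variable {S : Type*} [CommRing S] [Algebra W S]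

/-- The display group `G(S)_μ`: the points of `G(S)` given by homomorphisms of graded algebras
`A → S`, that is, the `𝔾ₘ`-equivariant morphisms `Spec S → G`. -/
def displayGroup (μ : A →ₐc[W] W[T;T⁻¹]) (𝒮 : ℤ → Submodule W S) : Set (WithConv (A →ₐ[W] S)) :=
  {g | ∀ n : ℤ, ∀ f ∈ weightSpace μ n, g.ofConv f ∈ 𝒮 n}

/-- For a closed subscheme `H ⊆ G` defined by an ideal `I` of `A`, stable under the action of
`𝔾ₘ`, the set `H(S)_μ` of `𝔾ₘ`-equivariant morphisms `Spec S → H`, as a subset of `G(S)`. -/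
def equivariantPoints (μ : A →ₐc[W] W[T;T⁻¹]) (𝒮 : ℤ → Submodule W S) (I : Ideal A) :
    Set (WithConv (A →ₐ[W] S)) :=
  {g | g ∈ displayGroup μ 𝒮 ∧ ∀ f ∈ I, g.ofConv f = 0}

/-- `P⁻(S)_μ`. -/
def PMinus (μ : A →ₐc[W] W[T;T⁻¹]) (𝒮 : ℤ → Submodule W S) : Set (WithConv (A →ₐ[W] S)) :=
  equivariantPoints μ 𝒮 (idealPMinus μ)

/-- `U⁺(S)_μ`. -/
def UPlus (μ : A →ₐc[W] W[T;T⁻¹]) (𝒮 : ℤ → Submodule W S) : Set (WithConv (A →ₐ[W] S)) :=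
  equivariantPoints μ 𝒮 (idealUPlus μ)

end Weights

end GDisplay

end

/-! Multiplication m : P⁻ × U⁺ → G is a monomorphism because P⁻ ∩ U⁺ = 1: a point in both agrees
with the unit in every weight (`eq_of_mul_eq_mul`). It is also formally smooth. Homogeneous points
lift along square-zero extensions (`exists_lift_mem_displayGroup`), so P⁻ and U⁺ are formally
smooth, and an infinitesimal point of G splits into its weights ≤ 0 and > 0
(`exists_mul_eq_of_comp_eq_one`). Over a Noetherian base m is therefore smooth, so A → `BigCell μ`
is a flat epimorphism.

Pull m back along an equivariant g : Spec S → G. The result S → C is a flat epimorphism, and C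
carries a compatible 𝔾ₘ-coaction. Such a map is an isomorphism once no proper homogeneous ideal I of
S generates the unit ideal of C (`bijective_of_flat_of_isEpi`). This is where the frame axioms
enter: they put SₙS₋ₙ into the Jacobson radical of S₀ for n ≠ 0 (`decompose_mul_mem`), so I is
killed by some S → S₀/𝔪 that vanishes in nonzero degrees. There g becomes a point of P⁻, so this map
extends to C and IC ≠ C.

Inverting S → C yields the factorization of g. Its factors are equivariant because factorizations
over S[T, T⁻¹] are unique as well. -/

noncomputable section

namespace GDisplay

open WithConv

/-! ### Group law on points and conjugation through the cocharacter -/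

section Points

variable {W : Type*} [CommRing W] {A : Type*} [CommRing A] [HopfAlgebra W A]
variable {X Y : Type*} [CommRing X] [Algebra W X] [CommRing Y] [Algebra W Y]

/-- The inverse of a point of the affine group scheme `Spec A`. -/
def pointInv (g : WithConv (A →ₐ[W] X)) : WithConv (A →ₐ[W] X) :=
  toConv (g.ofConv.comp (HopfAlgebra.antipodeAlgHom W A))

lemma comp_mul (φ : X →ₐ[W] Y) (g h : WithConv (A →ₐ[W] X)) :
    toConv (φ.comp (g * h).ofConv) = toConv (φ.comp g.ofConv) * toConv (φ.comp h.ofConv) := by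
  rw [AlgHom.comp_convMul_distrib]

lemma comp_one (φ : X →ₐ[W] Y) :
    toConv (φ.comp (1 : WithConv (A →ₐ[W] X)).ofConv) = 1 := by
  ext a
  simp [AlgHom.convOne_def]

lemma pointInv_mul (g : WithConv (A →ₐ[W] X)) : pointInv g * g = 1 := by
  have h := comp_mul g.ofConv (toConv (HopfAlgebra.antipodeAlgHom W A)) (toConv (AlgHom.id W A))
  rw [AlgHom.antipode_id_cancel, comp_one] at h
  exact h.symm

lemma id_mul_antipodeAlgHom :
    toConv (AlgHom.id W A) * toConv (HopfAlgebra.antipodeAlgHom W A) = 1 := by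
  apply WithConv.ofConv_injective
  apply AlgHom.toLinearMap_injective
  apply WithConv.toConv_injective
  rw [AlgHom.toLinearMap_convMul, AlgHom.toLinearMap_convOne]
  simp [LinearMap.id_mul_antipode]

lemma mul_pointInv (g : WithConv (A →ₐ[W] X)) : g * pointInv g = 1 := by
  have h := comp_mul g.ofConv (toConv (AlgHom.id W A)) (toConv (HopfAlgebra.antipodeAlgHom W A))
  rw [id_mul_antipodeAlgHom, comp_one] at h
  exact h.symm

lemma eq_pointInv {g h : WithConv (A →ₐ[W] X)} (hgh : g * h = 1) : h = pointInv g :=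
  (left_inv_eq_right_inv (pointInv_mul g) hgh).symm

lemma comp_pointInv (φ : X →ₐ[W] Y) (g : WithConv (A →ₐ[W] X)) :
    toConv (φ.comp (pointInv g).ofConv) = pointInv (toConv (φ.comp g.ofConv)) := rfl

/-- The inclusion of the constants as a homomorphism of `W`-algebras. -/
def laurentConst (W X : Type*) [CommRing W] [CommRing X] [Algebra W X] : X →ₐ[W] X[T;T⁻¹] :=
  IsScalarTower.toAlgHom W X X[T;T⁻¹]

@[simp] lemma laurentConst_apply (x : X) : laurentConst W X x = LaurentPolynomial.C x := rfl

/-- The structural map on Laurent polynomials. -/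
def laurentVar (W X : Type*) [CommRing W] [CommRing X] [Algebra W X] :
    W[T;T⁻¹] →ₐ[W] X[T;T⁻¹] :=
  AddMonoidAlgebra.lift W X[T;T⁻¹] ℤ (AddMonoidAlgebra.of X ℤ)

@[simp] lemma laurentVar_T (n : ℤ) :
    laurentVar W X (LaurentPolynomial.T n) = LaurentPolynomial.T n := by
  rw [LaurentPolynomial.T, laurentVar, AddMonoidAlgebra.lift_single, one_smul]
  rfl

/-- The action of a point `u` of `𝔾ₘ` on points of `G` by conjugation through `μ`. -/
def conj (μ : A →ₐc[W] W[T;T⁻¹]) (u : W[T;T⁻¹] →ₐ[W] X) (g : WithConv (A →ₐ[W] X)) :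
    WithConv (A →ₐ[W] X) :=
  toConv ((Algebra.TensorProduct.lift g.ofConv u (fun _ _ => Commute.all _ _)).comp
    (conjCoaction μ))

variable (μ : A →ₐc[W] W[T;T⁻¹])

/-- The value of the cocharacter `μ` at a point of `𝔾ₘ`. -/
def cochar (u : W[T;T⁻¹] →ₐ[W] X) : WithConv (A →ₐ[W] X) :=
  toConv (u.comp (μ : A →ₐ[W] W[T;T⁻¹]))

lemma conj_eq (u : W[T;T⁻¹] →ₐ[W] X) (g : WithConv (A →ₐ[W] X)) :
    conj μ u g = pointInv (cochar μ u) * g * cochar μ u := by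
  unfold conj conjCoaction
  simp only
  rw [comp_mul, comp_mul]
  congr 1
  · congr 1
    · ext a
      simp [pointInv, cochar]
    · ext a
      simp
  · ext a
    simp [cochar]

lemma conj_mul (u : W[T;T⁻¹] →ₐ[W] X) (g h : WithConv (A →ₐ[W] X)) :
    conj μ u (g * h) = conj μ u g * conj μ u h := by
  simp only [conj_eq, mul_assoc]
  rw [← mul_assoc (cochar μ u) (pointInv _), mul_pointInv, one_mul]

lemma conj_one (u : W[T;T⁻¹] →ₐ[W] X) : conj μ u 1 = 1 := by
  rw [conj_eq, mul_one, pointInv_mul]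

lemma conj_pointInv (u : W[T;T⁻¹] →ₐ[W] X) (g : WithConv (A →ₐ[W] X)) :
    conj μ u (pointInv g) = pointInv (conj μ u g) := by
  apply eq_pointInv
  rw [← conj_mul, mul_pointInv, conj_one]

lemma comp_conj (φ : X →ₐ[W] Y) (u : W[T;T⁻¹] →ₐ[W] X) (g : WithConv (A →ₐ[W] X)) :
    toConv (φ.comp (conj μ u g).ofConv) = conj μ (φ.comp u) (toConv (φ.comp g.ofConv)) := by
  simp only [conj_eq, comp_mul, comp_pointInv]
  rfl

/-- The product of two points of `𝔾ₘ`. -/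
def gmMul (u v : W[T;T⁻¹] →ₐ[W] X) : W[T;T⁻¹] →ₐ[W] X :=
  (toConv u * toConv v).ofConv

@[simp] lemma gmMul_T (u v : W[T;T⁻¹] →ₐ[W] X) (n : ℤ) :
    gmMul u v (LaurentPolynomial.T n) = u (LaurentPolynomial.T n) * v (LaurentPolynomial.T n) := by
  change (toConv u * toConv v) _ = _
  rw [AlgHom.convMul_apply, LaurentPolynomial.comul_T]
  simp

lemma cochar_gmMul (u v : W[T;T⁻¹] →ₐ[W] X) :
    cochar μ (gmMul u v) = cochar μ u * cochar μ v := by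
  unfold cochar gmMul
  rw [AlgHom.convMul_comp_bialgHom_distrib]

lemma pointInv_mul_rev (g h : WithConv (A →ₐ[W] X)) :
    pointInv (g * h) = pointInv h * pointInv g := by
  symm
  apply eq_pointInv
  rw [mul_assoc, ← mul_assoc h, mul_pointInv, one_mul, mul_pointInv]

lemma conj_conj (u v : W[T;T⁻¹] →ₐ[W] X) (g : WithConv (A →ₐ[W] X)) :
    conj μ v (conj μ u g) = conj μ (gmMul u v) g := by
  simp only [conj_eq, cochar_gmMul, pointInv_mul_rev, mul_assoc]

lemma conj_one_left (g : WithConv (A →ₐ[W] X)) :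
    conj μ ((1 : WithConv (W[T;T⁻¹] →ₐ[W] X)).ofConv) g = g := by
  have h : cochar μ ((1 : WithConv (W[T;T⁻¹] →ₐ[W] X)).ofConv) = 1 := by
    ext a
    simp [cochar, AlgHom.convOne_def]
  have h' : pointInv (1 : WithConv (A →ₐ[W] X)) = 1 := (eq_pointInv (mul_one 1)).symm
  rw [conj_eq, h, h', one_mul, mul_one]

lemma conj_apply_of_mem (u : W[T;T⁻¹] →ₐ[W] X) (g : WithConv (A →ₐ[W] X)) {n : ℤ} {f : A}
    (hf : f ∈ weightSpace μ n) :
    (conj μ u g).ofConv f = g.ofConv f * u (LaurentPolynomial.T n) := by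
  have hf' : conjCoaction μ f = f ⊗ₜ[W] LaurentPolynomial.T n := hf
  simp [conj, hf']

end Points

/-! ### The weight grading of the coordinate ring -/

section Grading

variable {W : Type*} [CommRing W] {A : Type*} [CommRing A] [HopfAlgebra W A]
variable {X Y : Type*} [CommRing X] [Algebra W X] [CommRing Y] [Algebra W Y]

/-- The evaluation of a Laurent polynomial over `A` at a point of `𝔾ₘ`. -/
def laurentEval (g : A →ₐ[W] X) (u : W[T;T⁻¹] →ₐ[W] X) : A[T;T⁻¹] →ₐ[W] X :=
  AddMonoidAlgebra.liftNCAlgHom g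
    ((u : W[T;T⁻¹] →* X).comp (AddMonoidAlgebra.of W ℤ)) (fun _ _ => Commute.all _ _)

lemma laurentEval_eq_sum (g : A →ₐ[W] X) (u : W[T;T⁻¹] →ₐ[W] X) (x : A[T;T⁻¹]) :
    laurentEval g u x = x.coeff.sum fun n a => g a * u (LaurentPolynomial.T n) := rfl

/-- Moves the coaction from A ⊗ W[T, T⁻¹] to A[T, T⁻¹], where weight components can be read off as
coefficients. -/
lemma laurentEval_comp_lift (g : A →ₐ[W] X) (u : W[T;T⁻¹] →ₐ[W] X) :
    (laurentEval g u).comp (Algebra.TensorProduct.lift (laurentConst W A) (laurentVar W A)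
      (fun _ _ => Commute.all _ _)) =
    Algebra.TensorProduct.lift g u (fun _ _ => Commute.all _ _) := by
  apply Algebra.TensorProduct.ext
  · ext a
    simp [laurentEval_eq_sum, ← LaurentPolynomial.single_eq_C, -LaurentPolynomial.single_eq_C_mul_T]
  · refine AddMonoidAlgebra.algHom_ext (fun n => ?_) (Subsingleton.elim _ _)
    have h : (AddMonoidAlgebra.single n 1 : W[T;T⁻¹]) = LaurentPolynomial.T n := rfl
    simp only [h, AlgHom.comp_apply, AlgHom.restrictScalars_apply,
      Algebra.TensorProduct.includeRight_apply, Algebra.TensorProduct.lift_tmul, map_one, one_mul,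
      laurentVar_T, laurentEval_eq_sum]
    simp [LaurentPolynomial.T, -LaurentPolynomial.single_eq_C_mul_T]

variable (μ : A →ₐc[W] W[T;T⁻¹])

/-- The weight components of an element of `A`. -/
def weightComponents (f : A) : ℤ →₀ A :=
  (conj μ (laurentVar W A) (toConv (laurentConst W A))).ofConv f |>.coeff

lemma conj_apply_eq_sum (u : W[T;T⁻¹] →ₐ[W] X) (g : WithConv (A →ₐ[W] X)) (f : A) :
    (conj μ u g).ofConv f =
      (weightComponents μ f).sum fun n a => g.ofConv a * u (LaurentPolynomial.T n) := by
  rw [weightComponents, ← laurentEval_eq_sum, conj, conj, ← laurentEval_comp_lift]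
  rfl

/-- This is the unit axiom of the action: conjugation by the trivial point of 𝔾ₘ sends every T ^ n
to 1. -/
lemma sum_weightComponents (f : A) : (weightComponents μ f).sum (fun _ a => a) = f := by
  have h := conj_apply_eq_sum μ ((1 : WithConv (W[T;T⁻¹] →ₐ[W] A)).ofConv)
    (toConv (AlgHom.id W A)) f
  rw [conj_one_left] at h
  refine Eq.trans (Finset.sum_congr rfl fun n _ => ?_) h.symm
  simp [AlgHom.convOne_def]

lemma coeff_sum_C_mul_T (p : ℤ →₀ A) (F : ℤ → A → X) (hF : ∀ n, F n 0 = 0) (m : ℤ) :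
    (p.sum fun n a => LaurentPolynomial.C (F n a) * LaurentPolynomial.T n : X[T;T⁻¹]).coeff m =
      F m (p m) := by
  simp only [← LaurentPolynomial.single_eq_C_mul_T, Finsupp.sum, AddMonoidAlgebra.coeff_sum,
    AddMonoidAlgebra.coeff_single, Finsupp.finsetSum_apply]
  rw [Finset.sum_eq_single m]
  · simp
  · intro b _ hb
    simp [hb]
  · intro h
    simp [Finsupp.notMem_support_iff.mp h, hF]

/-- This is associativity of the action: conjugating the universal point first by the universal `u₀`
and then by T is conjugation by their product. Compare coefficients of T ^ n. -/
lemma weightComponents_mem (f : A) (n : ℤ) : weightComponents μ f n ∈ weightSpace μ n := by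
  let R := A ⊗[W] W[T;T⁻¹]
  let u₀ : W[T;T⁻¹] →ₐ[W] R := Algebra.TensorProduct.includeRight
  let g₀ : WithConv (A →ₐ[W] R) := toConv Algebra.TensorProduct.includeLeft
  have hρ : conj μ u₀ g₀ = toConv (conjCoaction μ) := by
    unfold conj
    have e : Algebra.TensorProduct.lift g₀.ofConv u₀ (fun _ _ => Commute.all _ _) =
        AlgHom.id W R := Algebra.TensorProduct.lift_includeLeft_includeRight
    rw [e, AlgHom.id_comp]
  let c := laurentConst W R
  have h : conj μ (laurentVar W R) (toConv (c.comp (conj μ u₀ g₀).ofConv)) =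
      conj μ (gmMul (c.comp u₀) (laurentVar W R)) (toConv (c.comp g₀.ofConv)) := by
    rw [comp_conj, conj_conj]
  have h' := congrArg (fun x => (x.ofConv f).coeff n) h
  simp only [conj_apply_eq_sum, hρ] at h'
  have e₁ := coeff_sum_C_mul_T (X := R) (weightComponents μ f) (fun _ a => conjCoaction μ a)
    (by simp) n
  have e₂ := coeff_sum_C_mul_T (X := R) (weightComponents μ f)
    (fun m a => a ⊗ₜ[W] LaurentPolynomial.T m) (by simp) n
  change conjCoaction μ _ = _
  rw [← e₁, ← e₂]
  convert h' using 3
  · simp [c]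
  · refine Finsupp.sum_congr fun m _ => ?_
    simp only [gmMul_T, laurentVar_T, ← mul_assoc]
    congr 1
    change _ = LaurentPolynomial.C (_ ⊗ₜ[W] 1) * LaurentPolynomial.C (1 ⊗ₜ[W] _)
    rw [← map_mul, Algebra.TensorProduct.tmul_mul_tmul, mul_one, one_mul]

lemma weightComponents_of_mem {n : ℤ} {f : A} (hf : f ∈ weightSpace μ n) :
    weightComponents μ f = Finsupp.single n f := by
  rw [weightComponents, conj_apply_of_mem μ _ _ hf]
  simp [← LaurentPolynomial.single_eq_C_mul_T]

lemma weightComponents_add (f g : A) :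
    weightComponents μ (f + g) = weightComponents μ f + weightComponents μ g := by
  simp [weightComponents]

instance weightSpace_gradedMonoid : SetLike.GradedMonoid (weightSpace μ) where
  one_mem := by
    change conjCoaction μ 1 = _
    simp [Algebra.TensorProduct.one_def]
  mul_mem := by
    intro m n a b ha hb
    change conjCoaction μ a = _ at ha
    change conjCoaction μ b = _ at hb
    change conjCoaction μ (a * b) = _
    rw [map_mul, ha, hb, Algebra.TensorProduct.tmul_mul_tmul, LaurentPolynomial.T_add]

lemma weightSpace_isInternal : DirectSum.IsInternal (weightSpace μ) := by
  constructor
  · rw [injective_iff_map_eq_zero]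
    intro x hx
    have h : ∀ (x : DirectSum ℤ fun i => weightSpace μ i) (n : ℤ),
        weightComponents μ (DirectSum.coeAddMonoidHom (weightSpace μ) x) n = x n := by
      intro x n
      induction x using DirectSum.induction_on with
      | zero => simp [weightComponents]
      | of i a =>
        rw [DirectSum.coeAddMonoidHom_of, weightComponents_of_mem μ a.2,
          DirectSum.coe_of_apply, Finsupp.single_apply]
        split_ifs <;> rfl
      | add x y hx hy => simp [weightComponents_add, hx, hy]
    ext n
    rw [← h, hx]
    simp [weightComponents]
  · intro f
    refine ⟨∑ n ∈ (weightComponents μ f).support,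
      DirectSum.of (fun i => weightSpace μ i) n ⟨_, weightComponents_mem μ f n⟩, ?_⟩
    rw [map_sum]
    simp only [DirectSum.coeAddMonoidHom_of]
    exact sum_weightComponents μ f

instance weightSpace_gradedAlgebra : GradedAlgebra (weightSpace μ) where
  toDecomposition := (weightSpace_isInternal μ).chooseDecomposition

end Grading

/-! ### Homogeneous points and their infinitesimal lifting -/

section Cones

variable {W : Type*} [CommRing W] {A : Type*} [CommRing A] [HopfAlgebra W A]
variable {X Y : Type*} [CommRing X] [Algebra W X] [CommRing Y] [Algebra W Y]
variable (μ : A →ₐc[W] W[T;T⁻¹])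

/-- Two homomorphisms which agree on all weight spaces are equal. -/
lemma algHom_ext_of_weights {g h : A →ₐ[W] X}
    (H : ∀ n : ℤ, ∀ f ∈ weightSpace μ n, g f = h f) : g = h := by
  ext f
  rw [← sum_weightComponents μ f, Finsupp.sum, map_sum, map_sum]
  exact Finset.sum_congr rfl fun n _ => H n _ (weightComponents_mem μ f n)

/-- Homomorphisms can be glued from a different linear formula in each weight; none of the formulas
need be multiplicative by itself. -/
lemma exists_algHom_of_weights (F : ℤ → A →ₗ[W] X) (hone : F 0 1 = 1)
    (hmul : ∀ m n : ℤ, ∀ a ∈ weightSpace μ m, ∀ b ∈ weightSpace μ n,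
      F (m + n) (a * b) = F m a * F n b) :
    ∃ φ : A →ₐ[W] X, ∀ n : ℤ, ∀ f ∈ weightSpace μ n, φ f = F n f := by
  let ψ := DirectSum.toAlgebra (R := W) (fun n => weightSpace μ n)
    (fun n => (F n).comp (weightSpace μ n).subtype) hone (fun {i j} a b => hmul i j a a.2 b b.2)
  refine ⟨ψ.comp (DirectSum.decomposeAlgEquiv (weightSpace μ)).toAlgHom, fun n f hf => ?_⟩
  change ψ (DirectSum.decompose (weightSpace μ) f) = _
  rw [DirectSum.decompose_of_mem _ hf]
  exact DirectSum.toAddMonoid_of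
    (fun i => ((F i).comp (weightSpace μ i).subtype).toAddMonoidHom) n ⟨f, hf⟩

/-- The point `μ(T)⁻¹ g μ(T)` with values in Laurent polynomials. -/
def twist (g : WithConv (A →ₐ[W] X)) : WithConv (A →ₐ[W] X[T;T⁻¹]) :=
  conj μ (laurentVar W X) (toConv ((laurentConst W X).comp g.ofConv))

lemma twist_mul (g h : WithConv (A →ₐ[W] X)) : twist μ (g * h) = twist μ g * twist μ h := by
  simp only [twist, comp_mul, conj_mul]

lemma twist_pointInv (g : WithConv (A →ₐ[W] X)) :
    twist μ (pointInv g) = pointInv (twist μ g) := by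
  rw [twist, comp_pointInv, conj_pointInv, twist]

lemma twist_one : twist μ (1 : WithConv (A →ₐ[W] X)) = 1 := by
  rw [twist, comp_one, conj_one]

lemma twist_apply_of_mem (g : WithConv (A →ₐ[W] X)) {n : ℤ} {f : A} (hf : f ∈ weightSpace μ n) :
    (twist μ g).ofConv f = LaurentPolynomial.C (g.ofConv f) * LaurentPolynomial.T n := by
  rw [twist, conj_apply_of_mem μ _ _ hf]
  simp

lemma coeff_twist (g : WithConv (A →ₐ[W] X)) (f : A) (n : ℤ) :
    ((twist μ g).ofConv f).coeff n = g.ofConv (weightComponents μ f n) := by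
  rw [twist, conj_apply_eq_sum, ← coeff_sum_C_mul_T (weightComponents μ f)
    (fun _ a => g.ofConv a) (by simp) n]
  simp

/-- The unit section is fixed by conjugation, so its twist has only a constant term. -/
lemma counit_eq_zero {n : ℤ} (hn : n ≠ 0) {f : A} (hf : f ∈ weightSpace μ n) :
    Coalgebra.counit (R := W) f = 0 := by
  have h := twist_apply_of_mem μ (1 : WithConv (A →ₐ[W] W)) hf
  rw [twist_one] at h
  have h' := congrArg (fun p => AddMonoidAlgebra.coeff p n) h
  rw [← LaurentPolynomial.single_eq_C_mul_T] at h'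
  change (LaurentPolynomial.C (Coalgebra.counit (R := W) f)).coeff n = _ at h'
  rw [LaurentPolynomial.C_apply, if_neg hn, AddMonoidAlgebra.coeff_single,
    Finsupp.single_eq_same] at h'
  exact h'.symm

lemma coeff_mul_mem {M : Type*} [SetLike M X] [AddSubmonoidClass M X] (p q : X[T;T⁻¹]) (n : ℤ)
    (N : M) (h : ∀ i j, i + j = n → p.coeff i * q.coeff j ∈ N) : (p * q).coeff n ∈ N := by
  rw [AddMonoidAlgebra.coeff_mul]
  refine sum_mem fun i _ => sum_mem fun j _ => ?_
  dsimp only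
  split_ifs with hij
  · exact h i j hij
  · exact zero_mem _

/-- The Laurent polynomials whose coefficients lie in a multiplicative family of submodules. -/
def coneSubalgebra (Q : ℤ → Submodule W X) [SetLike.GradedMonoid Q] : Subalgebra W X[T;T⁻¹] where
  carrier := {p | ∀ n, p.coeff n ∈ Q n}
  mul_mem' := fun {p q} hp hq n => coeff_mul_mem p q n (Q n) fun i j hij =>
    hij ▸ SetLike.GradedMul.mul_mem (hp i) (hq j)
  add_mem' := fun hp hq n => add_mem (hp n) (hq n)
  algebraMap_mem' := fun r n => by
    rw [LaurentPolynomial.algebraMap_apply, LaurentPolynomial.C_apply]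
    split_ifs with h
    · rw [h, Algebra.algebraMap_eq_smul_one]
      exact Submodule.smul_mem _ _ SetLike.GradedOne.one_mem
    · exact zero_mem _

/-- Homogeneity becomes the condition that a point takes values in a subalgebra, which is clearly
stable under the group operations. `Q` need not be a grading of X, so this also covers P⁻ and U⁺. -/
lemma mem_displayGroup_iff_twist (Q : ℤ → Submodule W X) [SetLike.GradedMonoid Q]
    (g : WithConv (A →ₐ[W] X)) :
    g ∈ displayGroup μ Q ↔ ∀ f, (twist μ g).ofConv f ∈ coneSubalgebra Q := by
  refine ⟨fun h f n => ?_, fun h n f hf => ?_⟩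
  · rw [coeff_twist]
    exact h n _ (weightComponents_mem μ f n)
  · have := h f n
    rwa [coeff_twist, weightComponents_of_mem μ hf, Finsupp.single_eq_same] at this

lemma mul_mem_displayGroup (Q : ℤ → Submodule W X) [SetLike.GradedMonoid Q]
    {g h : WithConv (A →ₐ[W] X)} (hg : g ∈ displayGroup μ Q) (hh : h ∈ displayGroup μ Q) :
    g * h ∈ displayGroup μ Q := by
  rw [mem_displayGroup_iff_twist] at hg hh ⊢
  intro f
  have e := comp_mul (coneSubalgebra Q).val (toConv ((twist μ g).ofConv.codRestrict _ hg))
    (toConv ((twist μ h).ofConv.codRestrict _ hh))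
  have e' : twist μ (g * h) = _ := (twist_mul μ g h).trans e.symm
  rw [e']
  exact Subtype.prop _

lemma pointInv_mem_displayGroup (Q : ℤ → Submodule W X) [SetLike.GradedMonoid Q]
    {g : WithConv (A →ₐ[W] X)} (hg : g ∈ displayGroup μ Q) :
    pointInv g ∈ displayGroup μ Q := by
  rw [mem_displayGroup_iff_twist] at hg ⊢
  intro f
  rw [twist_pointInv]
  exact hg _

/-- Homogeneous points lift homogeneously along square-zero extensions. -/
lemma exists_lift_mem_displayGroup [Algebra.FormallySmooth W A]
    (Q : ℤ → Submodule W X) [SetLike.GradedMonoid Q] (π : X →ₐ[W] Y)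
    (hπ : ∀ x y, π x = 0 → π y = 0 → x * y = 0) (g : WithConv (A →ₐ[W] Y))
    (hg : ∀ n : ℤ, ∀ f ∈ weightSpace μ n, ∃ x ∈ Q n, π x = g.ofConv f) :
    ∃ h ∈ displayGroup μ Q, π.comp h.ofConv = g.ofConv := by
  let ϖ : coneSubalgebra Q →ₐ[W] Y[T;T⁻¹] :=
    (AddMonoidAlgebra.mapAlgHom ℤ π).comp (coneSubalgebra Q).val
  have hϖ : ∀ p n, (ϖ p).coeff n = π (p.1.coeff n) := fun p n => by simp [ϖ]
  have hrange : ∀ f, (twist μ g).ofConv f ∈ ϖ.range := by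
    have hhom : ∀ n : ℤ, ∀ f ∈ weightSpace μ n, (twist μ g).ofConv f ∈ ϖ.range := by
      intro n f hf
      obtain ⟨x, hx, hxf⟩ := hg n f hf
      refine ⟨⟨.single n x, fun m => ?_⟩, ?_⟩
      · rw [AddMonoidAlgebra.coeff_single, Finsupp.single_apply]
        split_ifs with h
        · exact h ▸ hx
        · exact zero_mem _
      · rw [twist_apply_of_mem μ g hf, ← hxf, ← LaurentPolynomial.single_eq_C_mul_T]
        ext m
        change (ϖ _).coeff m = _
        rw [hϖ]
        simp only [AddMonoidAlgebra.coeff_single, Finsupp.single_apply]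
        split_ifs <;> simp
    intro f
    rw [← sum_weightComponents μ f, Finsupp.sum, map_sum]
    exact sum_mem fun n _ => hhom n _ (weightComponents_mem μ f n)
  have hnil : IsNilpotent (RingHom.ker (ϖ.rangeRestrict : coneSubalgebra Q →+* ϖ.range)) := by
    refine ⟨2, ?_⟩
    rw [pow_two, Ideal.zero_eq_bot, ← le_bot_iff, Ideal.mul_le]
    have hker : ∀ p ∈ RingHom.ker (ϖ.rangeRestrict : coneSubalgebra Q →+* ϖ.range), ∀ n,
        π (p.1.coeff n) = 0 := by
      intro p hp n
      have : ϖ p = 0 := congrArg Subtype.val hp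
      rw [← hϖ, this]
      rfl
    intro p hp q hq
    rw [Ideal.mem_bot]
    ext n
    have := coeff_mul_mem p.1 q.1 n (⊥ : Ideal X) fun i j _ => hπ _ _ (hker p hp i) (hker q hq j)
    simpa using this
  -- Formal smoothness lifts the twisted point, but the lift need not respect weights. It is
  -- corrected by keeping only the n-th coefficient in weight n.
  let φ := Algebra.FormallySmooth.liftOfSurjective ((twist μ g).ofConv.codRestrict _ hrange)
    ϖ.rangeRestrict ϖ.rangeRestrict_surjective hnil
  have hφ : ∀ f, ϖ (φ f) = (twist μ g).ofConv f := fun f => congrArg Subtype.val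
    (Algebra.FormallySmooth.liftOfSurjective_apply _ ϖ.rangeRestrict
      ϖ.rangeRestrict_surjective hnil f)
  have hφn : ∀ n : ℤ, ∀ f ∈ weightSpace μ n, ∀ m,
      π ((φ f).1.coeff m) = if n = m then g.ofConv f else 0 := by
    intro n f hf m
    rw [← hϖ, hφ, twist_apply_of_mem μ g hf, ← LaurentPolynomial.single_eq_C_mul_T,
      AddMonoidAlgebra.coeff_single, Finsupp.single_apply]
  let F : ℤ → A →ₗ[W] X := fun n =>
    { toFun := fun f => (φ f).1.coeff n
      map_add' := fun a b => by simp
      map_smul' := fun c a => by simp }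
  obtain ⟨ψ, hψ⟩ := exists_algHom_of_weights μ F
    (by
      change (φ 1).1.coeff 0 = 1
      rw [map_one]
      change (1 : X[T;T⁻¹]).coeff 0 = 1
      rw [← map_one LaurentPolynomial.C, LaurentPolynomial.C_apply, if_pos rfl])
    (by
      intro m n a ha b hb
      change (φ (a * b)).1.coeff (m + n) = (φ a).1.coeff m * (φ b).1.coeff n
      set p := (φ a).1 with hp
      set q := (φ b).1 with hq
      have e : (φ (a * b)).1 = p * q := by rw [map_mul]; rfl
      rw [e, AddMonoidAlgebra.coeff_mul, Finsupp.sum, Finset.sum_eq_single m]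
      · rw [Finsupp.sum, Finset.sum_eq_single n]
        · simp
        · intro j _ hj
          rw [if_neg (by omega)]
        · intro hn
          simp [Finsupp.notMem_support_iff.mp hn]
      -- Off the diagonal i = m, j = n, both coefficients lie in the kernel of π, so their product
      -- vanishes.
      · intro i _ hi
        refine Finset.sum_eq_zero fun j _ => ?_
        dsimp only
        split_ifs with hij
        · refine hπ _ _ ?_ ?_
          · rw [hp, hφn m a ha, if_neg (Ne.symm hi)]
          · rw [hq, hφn n b hb, if_neg (by omega)]
        · rfl
      · intro hm
        simp [Finsupp.notMem_support_iff.mp hm])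
  refine ⟨toConv ψ, fun n f hf => ?_, ?_⟩
  · change ψ f ∈ Q n
    rw [hψ n f hf]
    exact (φ f).2 n
  · refine algHom_ext_of_weights μ fun n f hf => ?_
    change π (ψ f) = _
    rw [hψ n f hf]
    exact (hφn n f hf n).trans (if_pos rfl)

end Cones

/-! ### P⁻ and U⁺: group laws, trivial intersection, smoothness, infinitesimal factorization -/

section Subgroups

variable {W : Type*} [CommRing W] {A : Type*} [CommRing A] [HopfAlgebra W A]
variable {X Y : Type*} [CommRing X] [Algebra W X] [CommRing Y] [Algebra W Y]
variable (μ : A →ₐc[W] W[T;T⁻¹])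

/-- The points of `P⁻`. -/
def IsMinus (g : WithConv (A →ₐ[W] X)) : Prop :=
  ∀ n : ℤ, 0 < n → ∀ f ∈ weightSpace μ n, g.ofConv f = 0

/-- The points of `U⁺`. -/
def IsUnip (g : WithConv (A →ₐ[W] X)) : Prop :=
  ∀ n : ℤ, n ≤ 0 → ∀ f ∈ weightSpace μ n,
    g.ofConv f = algebraMap W X (Coalgebra.counit (R := W) f)

lemma isMinus_iff (g : WithConv (A →ₐ[W] X)) :
    IsMinus μ g ↔ ∀ f ∈ idealPMinus μ, g.ofConv f = 0 := by
  change _ ↔ idealPMinus μ ≤ RingHom.ker g.ofConv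
  rw [idealPMinus, Ideal.span_le]
  constructor
  · rintro h f ⟨n, hn, hf⟩
    exact h n hn f hf
  · intro h n hn f hf
    exact h ⟨n, hn, hf⟩

lemma isUnip_iff (g : WithConv (A →ₐ[W] X)) :
    IsUnip μ g ↔ ∀ f ∈ idealUPlus μ, g.ofConv f = 0 := by
  change _ ↔ idealUPlus μ ≤ RingHom.ker g.ofConv
  rw [idealUPlus, sup_le_iff, idealPPlus, Ideal.span_le, Ideal.span_le]
  constructor
  · refine fun h => ⟨?_, ?_⟩
    · rintro f ⟨n, hn, hf⟩
      have := h n hn.le f hf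
      rwa [counit_eq_zero μ hn.ne hf, map_zero] at this
    · rintro f ⟨a, ha, rfl⟩
      simp [RingHom.mem_ker, h 0 le_rfl a ha]
  · rintro ⟨h₁, h₂⟩ n hn f hf
    rcases hn.lt_or_eq with hn | rfl
    · rw [counit_eq_zero μ hn.ne hf, map_zero]
      exact h₁ ⟨n, hn, hf⟩
    · have : g.ofConv (f - algebraMap W A (Coalgebra.counit (R := W) f)) = 0 := h₂ ⟨f, hf, rfl⟩
      rwa [map_sub, sub_eq_zero, AlgHom.commutes] at this

lemma isMinus_one : IsMinus μ (1 : WithConv (A →ₐ[W] X)) := by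
  intro n hn f hf
  change algebraMap W X (Coalgebra.counit (R := W) f) = 0
  rw [counit_eq_zero μ hn.ne' hf, map_zero]

lemma isUnip_one : IsUnip μ (1 : WithConv (A →ₐ[W] X)) := fun _ _ _ _ => rfl

variable {μ} in
lemma IsMinus.comp {g : WithConv (A →ₐ[W] X)} (hg : IsMinus μ g) (φ : X →ₐ[W] Y) :
    IsMinus μ (toConv (φ.comp g.ofConv)) := fun n hn f hf => by
  simp [hg n hn f hf]

variable {μ} in
lemma IsUnip.comp {g : WithConv (A →ₐ[W] X)} (hg : IsUnip μ g) (φ : X →ₐ[W] Y) :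
    IsUnip μ (toConv (φ.comp g.ofConv)) := fun n hn f hf => by
  simp [hg n hn f hf]

variable {μ} in
lemma IsMinus.eq_one {g : WithConv (A →ₐ[W] X)} (hg : IsMinus μ g) (hg' : IsUnip μ g) :
    g = 1 := by
  apply WithConv.ext
  refine algHom_ext_of_weights μ fun n f hf => ?_
  rcases le_or_gt n 0 with hn | hn
  · exact hg' n hn f hf
  · rw [hg n hn f hf, isMinus_one μ n hn f hf]

variable (W X) in
/-- The multiplicative family of submodules describing `P⁻`. -/
def minusCone (n : ℤ) : Submodule W X := if n ≤ 0 then ⊤ else ⊥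

lemma mem_minusCone {n : ℤ} {x : X} : x ∈ minusCone W X n ↔ (0 < n → x = 0) := by
  unfold minusCone
  split_ifs with h
  · simp [not_lt.mpr h]
  · simp [not_le.mp h]

instance : SetLike.GradedMonoid (minusCone W X) where
  one_mem := by simp [mem_minusCone]
  mul_mem := by
    intro m n a b ha hb
    rw [mem_minusCone] at *
    intro h
    rcases lt_or_ge 0 m with hm | hm
    · rw [ha hm, zero_mul]
    · rw [hb (by omega), mul_zero]

lemma isMinus_iff_mem (g : WithConv (A →ₐ[W] X)) :
    IsMinus μ g ↔ g ∈ displayGroup μ (minusCone W X) :=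
  ⟨fun h n f hf => mem_minusCone.mpr fun hn => h n hn f hf,
    fun h n hn f hf => mem_minusCone.mp (h n f hf) hn⟩

variable (W X) in
/-- The multiplicative family of submodules describing `U⁺`. -/
def plusCone (n : ℤ) : Submodule W (W × X) :=
  if n < 0 then ⊥ else if n = 0 then LinearMap.range (Algebra.linearMap W (W × X)) else
    Submodule.prod ⊥ ⊤

lemma mem_plusCone_neg {n : ℤ} (hn : n < 0) {x : W × X} : x ∈ plusCone W X n ↔ x = 0 := by
  simp [plusCone, hn]

lemma mem_plusCone_zero {x : W × X} :
    x ∈ plusCone W X 0 ↔ x.2 = algebraMap W X x.1 := by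
  simp only [plusCone, lt_irrefl, if_false, if_true, LinearMap.mem_range]
  constructor
  · rintro ⟨w, rfl⟩
    rfl
  · intro h
    exact ⟨x.1, Prod.ext rfl h.symm⟩

lemma mem_plusCone_pos {n : ℤ} (hn : 0 < n) {x : W × X} : x ∈ plusCone W X n ↔ x.1 = 0 := by
  simp [plusCone, hn.ne', not_lt.mpr hn.le, Submodule.mem_prod]

instance : SetLike.GradedMonoid (plusCone W X) where
  one_mem := by simp [mem_plusCone_zero]
  mul_mem := by
    intro m n a b ha hb
    rcases lt_trichotomy m 0 with hm | rfl | hm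
    · rw [(mem_plusCone_neg hm).mp ha, zero_mul]
      exact zero_mem _
    · rw [zero_add]
      rw [mem_plusCone_zero] at ha
      rcases lt_trichotomy n 0 with hn | rfl | hn
      · rw [(mem_plusCone_neg hn).mp hb, mul_zero]
        exact zero_mem _
      · rw [mem_plusCone_zero] at *
        simp [ha, hb]
      · rw [mem_plusCone_pos hn] at *
        simp [hb]
    · rw [mem_plusCone_pos hm] at ha
      rcases lt_or_ge n 0 with hn | hn
      · rw [(mem_plusCone_neg hn).mp hb, mul_zero]
        exact zero_mem _
      · rw [mem_plusCone_pos (by omega)]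
        simp [ha]

/-- The point of `G` with values in `W × X` with components `1` and `g`. -/
def augment (g : WithConv (A →ₐ[W] X)) : WithConv (A →ₐ[W] W × X) :=
  toConv ((Bialgebra.counitAlgHom W A).prod g.ofConv)

lemma eq_augment_iff {g : WithConv (A →ₐ[W] W × X)} {h : WithConv (A →ₐ[W] X)} :
    g = augment h ↔ toConv ((AlgHom.fst W W X).comp g.ofConv) = 1 ∧
      toConv ((AlgHom.snd W W X).comp g.ofConv) = h := by
  constructor
  · rintro rfl
    exact ⟨rfl, rfl⟩
  · rintro ⟨h₁, rfl⟩
    ext a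
    · exact congrArg (fun g => g.ofConv a) h₁
    · rfl

lemma augment_mul (g h : WithConv (A →ₐ[W] X)) : augment g * augment h = augment (g * h) := by
  have hg := eq_augment_iff.mp (rfl : augment g = augment g)
  have hh := eq_augment_iff.mp (rfl : augment h = augment h)
  rw [eq_augment_iff, comp_mul, comp_mul, hg.1, hg.2, hh.1, hh.2]
  simp

lemma pointInv_augment (g : WithConv (A →ₐ[W] X)) : pointInv (augment g) = augment (pointInv g) := by
  symm
  apply eq_pointInv
  rw [augment_mul, mul_pointInv]
  symm
  rw [eq_augment_iff, comp_one, comp_one]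
  simp

/-- In weight 0 the value must equal the counit, not merely lie in the image of W. Pairing g with
the unit section over W expresses this as membership in the graph of W → X. -/
lemma isUnip_iff_mem (g : WithConv (A →ₐ[W] X)) :
    IsUnip μ g ↔ augment g ∈ displayGroup μ (plusCone W X) := by
  constructor
  · intro h n f hf
    have e : (augment g).ofConv f = (Coalgebra.counit (R := W) f, g.ofConv f) := rfl
    rw [e]
    rcases lt_trichotomy n 0 with hn | rfl | hn
    · rw [mem_plusCone_neg hn, h n hn.le f hf, counit_eq_zero μ hn.ne hf, map_zero]
      rfl
    · rw [mem_plusCone_zero]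
      exact h 0 le_rfl f hf
    · rw [mem_plusCone_pos hn]
      exact counit_eq_zero μ hn.ne' hf
  · intro h n hn f hf
    have e := h n f hf
    rcases hn.lt_or_eq with hn | rfl
    · rw [mem_plusCone_neg hn] at e
      rw [counit_eq_zero μ hn.ne hf, map_zero]
      exact congrArg Prod.snd e
    · exact mem_plusCone_zero.mp e

variable {μ}

lemma IsMinus.mul {g h : WithConv (A →ₐ[W] X)} (hg : IsMinus μ g) (hh : IsMinus μ h) :
    IsMinus μ (g * h) := by
  rw [isMinus_iff_mem] at *
  exact mul_mem_displayGroup μ _ hg hh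

lemma IsMinus.pointInv {g : WithConv (A →ₐ[W] X)} (hg : IsMinus μ g) :
    IsMinus μ (pointInv g) := by
  rw [isMinus_iff_mem] at *
  exact pointInv_mem_displayGroup μ _ hg

lemma IsUnip.mul {g h : WithConv (A →ₐ[W] X)} (hg : IsUnip μ g) (hh : IsUnip μ h) :
    IsUnip μ (g * h) := by
  rw [isUnip_iff_mem] at *
  rw [← augment_mul]
  exact mul_mem_displayGroup μ _ hg hh

lemma IsUnip.pointInv {g : WithConv (A →ₐ[W] X)} (hg : IsUnip μ g) :
    IsUnip μ (pointInv g) := by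
  rw [isUnip_iff_mem] at *
  rw [← pointInv_augment]
  exact pointInv_mem_displayGroup μ _ hg

/-- The multiplication map `P⁻ × U⁺ → G` is a monomorphism. -/
lemma eq_of_mul_eq_mul {q q' h h' : WithConv (A →ₐ[W] X)} (hq : IsMinus μ q) (hq' : IsMinus μ q')
    (hh : IsUnip μ h) (hh' : IsUnip μ h') (e : q * h = q' * h') : q = q' ∧ h = h' := by
  have e₁ : GDisplay.pointInv q' * q = h' * GDisplay.pointInv h := by
    calc _ = GDisplay.pointInv q' * (q * h) * GDisplay.pointInv h := by
          simp only [mul_assoc, mul_pointInv, mul_one]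
      _ = _ := by
          rw [e]
          simp only [← mul_assoc, pointInv_mul, one_mul]
  have e₂ : GDisplay.pointInv q' * q = 1 :=
    (hq'.pointInv.mul hq).eq_one (e₁ ▸ hh'.mul hh.pointInv)
  have e₃ : q = q' := by
    calc q = q' * (GDisplay.pointInv q' * q) := by rw [← mul_assoc, mul_pointInv, one_mul]
      _ = q' := by rw [e₂, mul_one]
  refine ⟨e₃, ?_⟩
  rw [e₁] at e₂
  calc h = h' * GDisplay.pointInv h * h := by rw [e₂, one_mul]
    _ = h' := by rw [mul_assoc, pointInv_mul, mul_one]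

lemma IsMinus.exists_lift [Algebra.FormallySmooth W A] {g : WithConv (A →ₐ[W] Y)}
    (hg : IsMinus μ g) (π : X →ₐ[W] Y) (hπ : Function.Surjective π)
    (hπ' : ∀ x y, π x = 0 → π y = 0 → x * y = 0) :
    ∃ h : WithConv (A →ₐ[W] X), IsMinus μ h ∧ toConv (π.comp h.ofConv) = g := by
  obtain ⟨h, hh, e⟩ := exists_lift_mem_displayGroup μ (minusCone W X) π hπ' g (by
    intro n f hf
    rcases le_or_gt n 0 with hn | hn
    · obtain ⟨x, hx⟩ := hπ (g.ofConv f)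
      exact ⟨x, mem_minusCone.mpr fun h => absurd hn (not_le.mpr h), hx⟩
    · exact ⟨0, zero_mem _, by rw [map_zero, hg n hn f hf]⟩)
  exact ⟨h, (isMinus_iff_mem μ h).mpr hh, by rw [e]⟩

lemma IsUnip.exists_lift [Algebra.FormallySmooth W A] {g : WithConv (A →ₐ[W] Y)}
    (hg : IsUnip μ g) (π : X →ₐ[W] Y) (hπ : Function.Surjective π)
    (hπ' : ∀ x y, π x = 0 → π y = 0 → x * y = 0) :
    ∃ h : WithConv (A →ₐ[W] X), IsUnip μ h ∧ toConv (π.comp h.ofConv) = g := by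
  -- Being the identity on W, this map keeps a square-zero kernel and forces the first component of
  -- any lift of `augment g` to be the unit section.
  let π₁ : W × X →ₐ[W] W × Y := (AlgHom.fst W W X).prod (π.comp (AlgHom.snd W W X))
  have hπ₁ : ∀ x, π₁ x = (x.1, π x.2) := fun _ => rfl
  obtain ⟨h, hh, e⟩ := exists_lift_mem_displayGroup μ (plusCone W X) π₁ (by
      rintro ⟨a, x⟩ ⟨b, y⟩ hx hy
      simp only [hπ₁, Prod.mk_eq_zero] at hx hy
      rw [hx.1, Prod.mk_mul_mk, zero_mul, hπ' x y hx.2 hy.2]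
      rfl) (augment g) (by
    intro n f hf
    have hm := (isUnip_iff_mem μ g).mp hg n f hf
    rcases lt_trichotomy n 0 with hn | rfl | hn
    · rw [mem_plusCone_neg hn] at hm
      exact ⟨0, zero_mem _, by rw [hm, map_zero]⟩
    · rw [mem_plusCone_zero] at hm
      refine ⟨algebraMap W (W × X) ((augment g).ofConv f).1, by simp [mem_plusCone_zero], ?_⟩
      rw [AlgHom.commutes]
      exact Prod.ext rfl hm.symm
    · rw [mem_plusCone_pos hn] at hm
      obtain ⟨x, hx⟩ := hπ ((augment g).ofConv f).2
      exact ⟨(0, x), by simp [mem_plusCone_pos hn], Prod.ext hm.symm hx⟩)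
  have e' : h = augment (toConv ((AlgHom.snd W W X).comp h.ofConv)) := by
    rw [eq_augment_iff]
    refine ⟨?_, rfl⟩
    ext a
    exact congrArg (fun φ => (φ a).1) e
  refine ⟨toConv ((AlgHom.snd W W X).comp h.ofConv), ?_, ?_⟩
  · rw [isUnip_iff_mem, ← e']
    exact hh
  · ext a
    exact congrArg (fun φ => (φ a).2) e

variable (μ) in
/-- Infinitesimal points of `G` decompose as products of points of `P⁻` and `U⁺`. -/
lemma exists_mul_eq_of_comp_eq_one (π : X →ₐ[W] Y)
    (hπ : ∀ x y, π x = 0 → π y = 0 → x * y = 0) (y : WithConv (A →ₐ[W] X))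
    (hy : toConv (π.comp y.ofConv) = 1) :
    ∃ q h : WithConv (A →ₐ[W] X), IsMinus μ q ∧ IsUnip μ h ∧ q * h = y := by
  let ε : A →ₐ[W] X := (1 : WithConv (A →ₐ[W] X)).ofConv
  have hε : ∀ f, ε f = algebraMap W X (Coalgebra.counit (R := W) f) := fun _ => rfl
  have hyf : ∀ f, π (y.ofConv f) = algebraMap W Y (Coalgebra.counit (R := W) f) :=
    fun f => congrArg (fun g => g.ofConv f) hy
  have hy0 : ∀ n : ℤ, n ≠ 0 → ∀ f ∈ weightSpace μ n, π (y.ofConv f) = 0 := by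
    intro n hn f hf
    rw [hyf, counit_eq_zero μ hn hf, map_zero]
  have hε0 : ∀ n : ℤ, n ≠ 0 → ∀ f ∈ weightSpace μ n, ε f = 0 := by
    intro n hn f hf
    rw [hε, counit_eq_zero μ hn hf, map_zero]
  have hyε : ∀ f, π (y.ofConv f - ε f) = 0 := by
    intro f
    rw [map_sub, hyf, hε, AlgHom.commutes, sub_self]
  -- Truncating y to weights ≤ 0 is multiplicative: a product of elements of opposite nonzero
  -- weights goes to a product of two elements of the kernel of π, which is 0.
  obtain ⟨q, hq⟩ := exists_algHom_of_weights μ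
    (fun n => if n ≤ 0 then y.ofConv.toLinearMap else 0) (by simp) (by
      intro m n a ha b hb
      rcases le_or_gt m 0 with hm | hm <;> rcases le_or_gt n 0 with hn | hn
      · simp [hm, hn, add_nonpos hm hn]
      · simp only [hm, hn.not_ge, if_true, if_false, LinearMap.zero_apply, mul_zero]
        split_ifs with h
        · simpa using hπ _ _ (hy0 m (by omega) a ha) (hy0 n (by omega) b hb)
        · rfl
      · simp only [hm.not_ge, if_false, LinearMap.zero_apply, zero_mul]
        split_ifs with h
        · simpa using hπ _ _ (hy0 m (by omega) a ha) (hy0 n (by omega) b hb)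
        · rfl
      · simp [hm.not_ge, hn.not_ge, (add_pos hm hn).not_ge])
  -- The complementary truncation. Multiplicativity in mixed weights uses that y − ε takes values in
  -- the kernel of π, so y(a)y(b) = ε(a)y(b) when b has positive weight.
  obtain ⟨h, hh⟩ := exists_algHom_of_weights μ
    (fun n => if n ≤ 0 then ε.toLinearMap else y.ofConv.toLinearMap) (by simp) (by
      intro m n a ha b hb
      rcases le_or_gt m 0 with hm | hm <;> rcases le_or_gt n 0 with hn | hn
      · simp [hm, hn, add_nonpos hm hn]
      · simp only [hm, hn.not_ge, if_true, if_false, AlgHom.toLinearMap_apply]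
        split_ifs with h
        · rw [AlgHom.toLinearMap_apply, map_mul, hε0 m (by omega) a ha, zero_mul, zero_mul]
        · rw [AlgHom.toLinearMap_apply, map_mul, ← sub_eq_zero, ← sub_mul]
          exact hπ _ _ (hyε a) (hy0 n hn.ne' b hb)
      · simp only [hm.not_ge, hn, if_true, if_false, AlgHom.toLinearMap_apply]
        split_ifs with h
        · rw [AlgHom.toLinearMap_apply, map_mul, hε0 n (by omega) b hb, mul_zero, mul_zero]
        · rw [AlgHom.toLinearMap_apply, map_mul, ← sub_eq_zero, ← mul_sub]
          exact hπ _ _ (hy0 m hm.ne' a ha) (hyε b)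
      · simp [hm.not_ge, hn.not_ge, (add_pos hm hn).not_ge])
  have hqm : IsMinus μ (toConv q) := fun n hn f hf => by
    change q f = 0
    rw [hq n f hf, if_neg hn.not_ge]
    rfl
  have hhu : IsUnip μ (toConv h) := fun n hn f hf => by
    change h f = _
    rw [hh n f hf, if_pos hn]
    rfl
  have hq1 : toConv (π.comp q) = 1 := by
    apply WithConv.ext
    refine algHom_ext_of_weights μ fun n f hf => ?_
    change π (q f) = algebraMap W Y (Coalgebra.counit (R := W) f)
    rw [hq n f hf]
    split_ifs with hn
    · exact hyf f
    · rw [counit_eq_zero μ (by omega) hf]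
      simp
  have hh1 : toConv (π.comp h) = 1 := by
    apply WithConv.ext
    refine algHom_ext_of_weights μ fun n f hf => ?_
    change π (h f) = algebraMap W Y (Coalgebra.counit (R := W) f)
    rw [hh n f hf]
    split_ifs with hn
    · exact π.commutes _
    · exact hyf f
  refine ⟨toConv q, toConv h, hqm, hhu, ?_⟩
  -- Both q − 1 and h − 1 take values in a square-zero ideal, so their convolution vanishes and q *
  -- h = q + h − 1, which can be compared with y weight by weight.
  let d : WithConv (A →ₗ[W] X) := toConv q.toLinearMap - 1
  let e : WithConv (A →ₗ[W] X) := toConv h.toLinearMap - 1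
  have hd : ∀ f, π (d.ofConv f) = 0 := by
    intro f
    change π (q f - algebraMap W X _) = 0
    rw [map_sub, AlgHom.commutes, sub_eq_zero]
    exact congrArg (fun g => g.ofConv f) hq1
  have he : ∀ f, π (e.ofConv f) = 0 := by
    intro f
    change π (h f - algebraMap W X _) = 0
    rw [map_sub, AlgHom.commutes, sub_eq_zero]
    exact congrArg (fun g => g.ofConv f) hh1
  have hde : d * e = 0 := by
    apply WithConv.ext
    have : LinearMap.mul' W X ∘ₗ TensorProduct.map d.ofConv e.ofConv = 0 := by
      ext a b
      exact hπ _ _ (hd a) (he b)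
    change LinearMap.mul' W X ∘ₗ TensorProduct.map d.ofConv e.ofConv ∘ₗ Coalgebra.comul = 0
    rw [← LinearMap.comp_assoc, this, LinearMap.zero_comp]
  apply WithConv.ofConv_injective
  refine algHom_ext_of_weights μ fun n f hf => ?_
  have e₁ : toConv (toConv q * toConv h).ofConv.toLinearMap =
      toConv q.toLinearMap + toConv h.toLinearMap - 1 := by
    rw [AlgHom.toLinearMap_convMul]
    change toConv q.toLinearMap * toConv h.toLinearMap = _
    have : (toConv q.toLinearMap - 1) * (toConv h.toLinearMap - 1) = 0 := hde
    rw [sub_mul, mul_sub, mul_sub, mul_one, one_mul, one_mul] at this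
    rw [← sub_eq_zero, ← this]
    abel
  have e₂ : (toConv q * toConv h).ofConv f = q f + h f - ε f :=
    congrArg (fun g => g.ofConv f) e₁
  rw [e₂, hq n f hf, hh n f hf]
  split_ifs with hn
  · simp
  · simp [hε0 n (by omega) f hf]

end Subgroups

/-! ### The product P⁻ × U⁺ as a smooth monomorphism to G -/

lemma finiteType_tensorProduct (W B C : Type*) [CommRing W] [CommRing B] [CommRing C]
    [Algebra W B] [Algebra W C] [Algebra.FiniteType W B] [Algebra.FiniteType W C] :
    Algebra.FiniteType W (B ⊗[W] C) :=
  Algebra.FiniteType.trans (S := B) inferInstance inferInstance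

section BigCell

variable {W : Type*} [CommRing W] {A : Type*} [CommRing A] [HopfAlgebra W A]
variable {X : Type*} [CommRing X] [Algebra W X]
variable (μ : A →ₐc[W] W[T;T⁻¹])

/-- The coordinate ring of `P⁻ × U⁺`, considered as an algebra over the coordinate ring of `G`
by the multiplication map. -/
def BigCell : Type _ := (A ⧸ idealPMinus μ) ⊗[W] (A ⧸ idealUPlus μ)

namespace BigCell

instance : CommRing (BigCell μ) :=
  inferInstanceAs (CommRing ((A ⧸ idealPMinus μ) ⊗[W] (A ⧸ idealUPlus μ)))

instance : Algebra W (BigCell μ) :=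
  inferInstanceAs (Algebra W ((A ⧸ idealPMinus μ) ⊗[W] (A ⧸ idealUPlus μ)))

/-- The universal point of `P⁻`. -/
def minusPoint : WithConv (A →ₐ[W] BigCell μ) :=
  toConv ((Algebra.TensorProduct.includeLeft :
    A ⧸ idealPMinus μ →ₐ[W] (A ⧸ idealPMinus μ) ⊗[W] (A ⧸ idealUPlus μ)).comp
      (Ideal.Quotient.mkₐ W (idealPMinus μ)))

/-- The universal point of `U⁺`. -/
def unipPoint : WithConv (A →ₐ[W] BigCell μ) :=
  toConv ((Algebra.TensorProduct.includeRight :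
    A ⧸ idealUPlus μ →ₐ[W] (A ⧸ idealPMinus μ) ⊗[W] (A ⧸ idealUPlus μ)).comp
      (Ideal.Quotient.mkₐ W (idealUPlus μ)))

instance : Algebra A (BigCell μ) := (minusPoint μ * unipPoint μ).ofConv.toRingHom.toAlgebra

lemma algebraMap_apply (a : A) :
    algebraMap A (BigCell μ) a = (minusPoint μ * unipPoint μ).ofConv a := rfl

instance : IsScalarTower W A (BigCell μ) :=
  IsScalarTower.of_algebraMap_eq fun w =>
    ((minusPoint μ * unipPoint μ).ofConv.commutes w).symm

lemma isMinus_minusPoint : IsMinus μ (minusPoint μ) := by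
  rw [isMinus_iff]
  intro f hf
  change (Ideal.Quotient.mk (idealPMinus μ) f) ⊗ₜ[W] (1 : A ⧸ idealUPlus μ) = 0
  rw [Ideal.Quotient.eq_zero_iff_mem.mpr hf, TensorProduct.zero_tmul]

lemma isUnip_unipPoint : IsUnip μ (unipPoint μ) := by
  rw [isUnip_iff]
  intro f hf
  change (1 : A ⧸ idealPMinus μ) ⊗ₜ[W] (Ideal.Quotient.mk (idealUPlus μ) f) = 0
  rw [Ideal.Quotient.eq_zero_iff_mem.mpr hf, TensorProduct.tmul_zero]

variable {μ}

lemma exists_lift {q h : WithConv (A →ₐ[W] X)} (hq : IsMinus μ q) (hh : IsUnip μ h) :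
    ∃ φ : BigCell μ →ₐ[W] X, toConv (φ.comp (minusPoint μ).ofConv) = q ∧
      toConv (φ.comp (unipPoint μ).ofConv) = h := by
  rw [isMinus_iff] at hq
  rw [isUnip_iff] at hh
  let φ : (A ⧸ idealPMinus μ) ⊗[W] (A ⧸ idealUPlus μ) →ₐ[W] X :=
    Algebra.TensorProduct.lift (Ideal.Quotient.liftₐ _ q.ofConv hq)
      (Ideal.Quotient.liftₐ _ h.ofConv hh) (fun _ _ => Commute.all _ _)
  refine ⟨φ, ?_, ?_⟩
  · ext a
    change φ ((Ideal.Quotient.mk _ a) ⊗ₜ[W] 1) = _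
    simp only [φ, Algebra.TensorProduct.lift_tmul, map_one, mul_one]
    exact Ideal.Quotient.lift_mk _ _ _
  · ext a
    change φ (1 ⊗ₜ[W] (Ideal.Quotient.mk _ a)) = _
    simp only [φ, Algebra.TensorProduct.lift_tmul, map_one, one_mul]
    exact Ideal.Quotient.lift_mk _ _ _

lemma apply_algebraMap (φ : BigCell μ →ₐ[W] X) (a : A) :
    φ (algebraMap A (BigCell μ) a) = (toConv (φ.comp (minusPoint μ).ofConv) *
      toConv (φ.comp (unipPoint μ).ofConv)).ofConv a := by
  rw [← comp_mul]
  rfl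

/-- `A → BigCell μ` is an epimorphism. -/
lemma algHom_ext {φ ψ : BigCell μ →ₐ[W] X}
    (h : ∀ a, φ (algebraMap A (BigCell μ) a) = ψ (algebraMap A (BigCell μ) a)) : φ = ψ := by
  have e : toConv (φ.comp (minusPoint μ).ofConv) * toConv (φ.comp (unipPoint μ).ofConv) =
      toConv (ψ.comp (minusPoint μ).ofConv) * toConv (ψ.comp (unipPoint μ).ofConv) := by
    ext a
    have := h a
    rwa [apply_algebraMap, apply_algebraMap] at this
  obtain ⟨e₁, e₂⟩ := eq_of_mul_eq_mul ((isMinus_minusPoint μ).comp φ)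
    ((isMinus_minusPoint μ).comp ψ) ((isUnip_unipPoint μ).comp φ) ((isUnip_unipPoint μ).comp ψ) e
  refine Algebra.TensorProduct.ext (Ideal.Quotient.algHom_ext _ ?_)
    (Ideal.Quotient.algHom_ext _ ?_)
  · exact congrArg (fun g => g.ofConv) e₁
  · exact congrArg (fun g => g.ofConv) e₂

variable (μ)

/-- Given g over X with a factorization modulo I, lift the two factors separately to q and h. The
error q⁻¹gh⁻¹ is infinitesimal, hence equal to some q₁h₁, and g = (qq₁)(h₁h). -/
instance formallySmooth [Algebra.FormallySmooth W A] : Algebra.FormallySmooth A (BigCell μ) := by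
  refine Algebra.FormallySmooth.of_comp_surjective fun X _ _ I hI φ => ?_
  let _ : Algebra W X := Algebra.compHom X (algebraMap W A)
  have : IsScalarTower W A X := IsScalarTower.of_algebraMap_eq fun _ => rfl
  let π : X →ₐ[W] X ⧸ I := Ideal.Quotient.mkₐ W I
  have hπ : Function.Surjective π := Ideal.Quotient.mk_surjective
  have hπ' : ∀ x y, π x = 0 → π y = 0 → x * y = 0 := by
    intro x y hx hy
    have hx' : x ∈ I := Ideal.Quotient.eq_zero_iff_mem.mp hx
    have hy' : y ∈ I := Ideal.Quotient.eq_zero_iff_mem.mp hy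
    have := Ideal.mul_mem_mul hx' hy'
    rwa [← pow_two, hI, Ideal.mem_bot] at this
  let φ' : BigCell μ →ₐ[W] X ⧸ I := φ.restrictScalars W
  let g : WithConv (A →ₐ[W] X) := toConv (IsScalarTower.toAlgHom W A X)
  obtain ⟨q, hq, eq⟩ := ((isMinus_minusPoint μ).comp φ').exists_lift π hπ hπ'
  obtain ⟨h, hh, eh⟩ := ((isUnip_unipPoint μ).comp φ').exists_lift π hπ hπ'
  have eg : toConv (π.comp g.ofConv) = toConv (π.comp q.ofConv) * toConv (π.comp h.ofConv) := by
    rw [eq, eh]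
    ext a
    change π (algebraMap A X a) = _
    rw [← apply_algebraMap]
    exact (φ.commutes a).symm
  obtain ⟨q₁, h₁, hq₁, hh₁, e⟩ := exists_mul_eq_of_comp_eq_one μ π hπ'
    (pointInv q * g * pointInv h) (by
      rw [comp_mul, comp_mul, comp_pointInv, comp_pointInv, eg, ← mul_assoc, pointInv_mul,
        one_mul, mul_pointInv])
  have e' : g = (q * q₁) * (h₁ * h) := by
    calc g = q * (pointInv q * g * pointInv h) * h := by
          simp only [mul_assoc, pointInv_mul, mul_one]
          rw [← mul_assoc, mul_pointInv, one_mul]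
      _ = _ := by rw [← e]; simp only [mul_assoc]
  obtain ⟨ψ, hψ₁, hψ₂⟩ := exists_lift (hq.mul hq₁) (hh₁.mul hh)
  have hψ : ∀ a, ψ (algebraMap A (BigCell μ) a) = algebraMap A X a := by
    intro a
    rw [apply_algebraMap, hψ₁, hψ₂, ← e']
    rfl
  refine ⟨{ ψ with commutes' := hψ }, ?_⟩
  -- Since A → `BigCell μ` is an epimorphism, compatibility with φ modulo I need not be checked on
  -- the corrections q₁ and h₁.
  have : π.comp ψ = φ' := algHom_ext fun a => by
    rw [AlgHom.comp_apply, hψ]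
    exact (φ.commutes a).symm
  ext b
  exact congrArg (fun f => f b) this

/-- The Noetherian hypothesis upgrades finite type to finite presentation, so formal smoothness
becomes smoothness, which implies flatness. -/
instance flat [IsNoetherianRing W] [Algebra.Smooth W A] : Module.Flat A (BigCell μ) := by
  have : IsNoetherianRing A := Algebra.FiniteType.isNoetherianRing W A
  have : Algebra.FiniteType W (BigCell μ) := by
    have : Algebra.FiniteType W (A ⧸ idealPMinus μ) :=
      .of_surjective (Ideal.Quotient.mkₐ W _) (Ideal.Quotient.mk_surjective)
    have : Algebra.FiniteType W (A ⧸ idealUPlus μ) :=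
      .of_surjective (Ideal.Quotient.mkₐ W _) (Ideal.Quotient.mk_surjective)
    exact finiteType_tensorProduct W (A ⧸ idealPMinus μ) (A ⧸ idealUPlus μ)
  have : Algebra.FiniteType A (BigCell μ) :=
    Algebra.FiniteType.of_restrictScalars_finiteType W A (BigCell μ)
  have : Algebra.FinitePresentation A (BigCell μ) :=
    Algebra.FinitePresentation.of_finiteType.mp inferInstance
  have : Algebra.Smooth A (BigCell μ) := {}
  infer_instance

end BigCell

end BigCell

/-! ### Flat epimorphisms of graded rings -/

section FlatEpi

variable {S C : Type*} [CommRing S] [CommRing C] [Algebra S C]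

lemma ringHom_ext_of_isEpi [Algebra.IsEpi S C] {D : Type*} [CommRing D] {f g : C →+* D}
    (h : ∀ s, f (algebraMap S C s) = g (algebraMap S C s)) : f = g := by
  let _ : Algebra S D := (f.comp (algebraMap S C)).toAlgebra
  let f' : C →ₐ[S] D := { f with commutes' := fun _ => rfl }
  let g' : C →ₐ[S] D := { g with commutes' := fun s => (h s).symm }
  ext c
  have e := congrArg (Algebra.TensorProduct.lift f' g' fun _ _ => Commute.all _ _)
    ((Algebra.isEpi_iff_forall_one_tmul_eq S C).mp inferInstance c)
  simp only [Algebra.TensorProduct.lift_tmul, map_one, one_mul, mul_one] at e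
  exact e.symm

/-- If the image of `x` in a flat base change vanishes, then the annihilator of `x` generates
the unit ideal there. -/
lemma map_ker_toSpanSingleton_eq_top [Module.Flat S C] {N : Type*} [AddCommGroup N] [Module S N]
    (x : N) (hx : (1 : C) ⊗ₜ[S] x = 0) :
    Ideal.map (algebraMap S C) (LinearMap.ker (LinearMap.toSpanSingleton S N x)) = ⊤ := by
  set I : Ideal S := LinearMap.ker (LinearMap.toSpanSingleton S N x)
  have hex : Function.Exact (Submodule.subtype I) (LinearMap.toSpanSingleton S N x) := by
    intro s
    simp [I]
  obtain ⟨z, hz⟩ := (Module.Flat.lTensor_exact C hex ((1 : C) ⊗ₜ[S] (1 : S))).mp (by simp [hx])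
  rw [Ideal.eq_top_iff_one]
  have key : ∀ z : C ⊗[S] I, TensorProduct.rid S C ((Submodule.subtype I).lTensor C z) ∈
      Ideal.map (algebraMap S C) I := by
    intro z
    induction z with
    | zero => simp
    | tmul c i =>
      simp only [LinearMap.lTensor_tmul, Submodule.subtype_apply, TensorProduct.rid_tmul,
        Algebra.smul_def]
      exact Ideal.mul_mem_right _ _ (Ideal.mem_map_of_mem _ i.2)
    | add a b ha hb =>
      rw [map_add, map_add]
      exact add_mem ha hb
  have := key z
  rwa [hz, TensorProduct.rid_tmul, one_smul] at this

variable {E : Type*} [SetLike E S] [AddSubgroupClass E S] (𝒮 : ℤ → E) [GradedRing 𝒮]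

lemma coeff_coaction (ρ : C →+* C[T;T⁻¹])
    (hρ : ∀ n : ℤ, ∀ s ∈ 𝒮 n, ρ (algebraMap S C s) =
      LaurentPolynomial.C (algebraMap S C s) * LaurentPolynomial.T n) (s : S) (n : ℤ) :
    (ρ (algebraMap S C s)).coeff n = algebraMap S C (DirectSum.decompose 𝒮 s n) := by
  induction s using DirectSum.Decomposition.inductionOn 𝒮 with
  | zero => simp
  | @homogeneous i m =>
    rw [hρ i _ m.2, ← LaurentPolynomial.single_eq_C_mul_T, AddMonoidAlgebra.coeff_single,
      Finsupp.single_apply]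
    split_ifs with h
    · subst h
      rw [DirectSum.decompose_coe, DirectSum.of_eq_same]
    · rw [DirectSum.decompose_of_mem_ne 𝒮 m.2 h, map_zero]
  | add a b ha hb =>
    simp [ha, hb, DirectSum.decompose_add]

/-- Coassociativity of ρ. Both iterated coactions are ring homomorphisms out of C, so it suffices to
compare them on homogeneous elements of S. -/
lemma coaction_coeff [Algebra.IsEpi S C] (ρ : C →+* C[T;T⁻¹])
    (hρ : ∀ n : ℤ, ∀ s ∈ 𝒮 n, ρ (algebraMap S C s) =
      LaurentPolynomial.C (algebraMap S C s) * LaurentPolynomial.T n) (c : C) (n : ℤ) :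
    ρ ((ρ c).coeff n) = LaurentPolynomial.C ((ρ c).coeff n) * LaurentPolynomial.T n := by
  let δ : C[T;T⁻¹] →+* C[T;T⁻¹][T;T⁻¹] := AddMonoidAlgebra.liftNCRingHom
    (LaurentPolynomial.C.comp LaurentPolynomial.C)
    ({ toFun := fun m => LaurentPolynomial.C (LaurentPolynomial.T m.toAdd) *
          LaurentPolynomial.T m.toAdd
       map_one' := by simp
       map_mul' := fun a b => by
        simp only [toAdd_mul, LaurentPolynomial.T_add, map_mul]
        ring } : Multiplicative ℤ →* C[T;T⁻¹][T;T⁻¹]) (fun _ _ => Commute.all _ _)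
  have hδ : ∀ p : C[T;T⁻¹], δ p = p.coeff.sum fun m a =>
      LaurentPolynomial.C (LaurentPolynomial.C a * LaurentPolynomial.T m) *
        LaurentPolynomial.T m := by
    intro p
    change p.coeff.sum (fun m a => LaurentPolynomial.C (LaurentPolynomial.C a) *
      (LaurentPolynomial.C (LaurentPolynomial.T m) * LaurentPolynomial.T m)) = _
    simp only [map_mul, mul_assoc]
  have e : (AddMonoidAlgebra.mapRingHom ℤ ρ).comp ρ = δ.comp ρ := by
    apply ringHom_ext_of_isEpi (S := S)
    intro s
    induction s using DirectSum.Decomposition.inductionOn 𝒮 with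
    | zero => simp
    | @homogeneous i m =>
      simp only [RingHom.comp_apply]
      rw [hδ, hρ i _ m.2, ← LaurentPolynomial.single_eq_C_mul_T]
      rw [AddMonoidAlgebra.mapRingHom_single, hρ i _ m.2, AddMonoidAlgebra.coeff_single,
        Finsupp.sum_single_index (by simp), LaurentPolynomial.single_eq_C_mul_T]
    | add a b ha hb => rw [map_add, map_add, ha, hb, map_add]
  have e' := congrArg (fun φ => (φ c).coeff n) e
  simp only [RingHom.comp_apply] at e'
  rw [hδ, coeff_sum_C_mul_T (ρ c).coeff
    (fun m a => LaurentPolynomial.C a * LaurentPolynomial.T m) (by simp) n] at e'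
  rw [← e']
  simp

lemma sum_coeff_coaction [Algebra.IsEpi S C] (ρ : C →+* C[T;T⁻¹])
    (hρ : ∀ n : ℤ, ∀ s ∈ 𝒮 n, ρ (algebraMap S C s) =
      LaurentPolynomial.C (algebraMap S C s) * LaurentPolynomial.T n) (c : C) :
    (ρ c).coeff.sum (fun _ a => a) = c := by
  let ev : C[T;T⁻¹] →+* C := AddMonoidAlgebra.liftNCRingHom (RingHom.id C)
    (1 : Multiplicative ℤ →* C) (fun _ _ => Commute.all _ _)
  have hev : ∀ p : C[T;T⁻¹], ev p = p.coeff.sum fun _ a => a := by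
    intro p
    change p.coeff.sum (fun m a => a * 1) = _
    simp
  have e : ev.comp ρ = RingHom.id C := by
    apply ringHom_ext_of_isEpi (S := S)
    intro s
    induction s using DirectSum.Decomposition.inductionOn 𝒮 with
    | zero => simp
    | @homogeneous i m =>
      rw [RingHom.comp_apply, hev, hρ i _ m.2, ← LaurentPolynomial.single_eq_C_mul_T,
        AddMonoidAlgebra.coeff_single, Finsupp.sum_single_index rfl]
      rfl
    | add a b ha hb => rw [map_add, map_add, ha, hb, map_add]
  rw [← hev]
  exact congrArg (fun φ => φ c) e

/-- A flat epimorphism of graded rings, such that no proper homogeneous ideal generates the unit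
ideal in the target, is an isomorphism. -/
theorem bijective_of_flat_of_isEpi [Module.Flat S C] [Algebra.IsEpi S C] (ρ : C →+* C[T;T⁻¹])
    (hρ : ∀ n : ℤ, ∀ s ∈ 𝒮 n, ρ (algebraMap S C s) =
      LaurentPolynomial.C (algebraMap S C s) * LaurentPolynomial.T n)
    (hI : ∀ I : Ideal S, I.IsHomogeneous 𝒮 → I.map (algebraMap S C) = ⊤ → I = ⊤) :
    Function.Bijective (algebraMap S C) := by
  constructor
  · rw [injective_iff_map_eq_zero]
    have hhom : ∀ n : ℤ, ∀ s ∈ 𝒮 n, algebraMap S C s = 0 → s = 0 := by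
      intro n s hs h
      -- The annihilator of a homogeneous element is a homogeneous ideal; by flatness it generates
      -- the unit ideal of C, so it contains 1.
      have e := map_ker_toSpanSingleton_eq_top (C := C) s (by
        have : (1 : C) ⊗ₜ[S] s = (s • (1 : C)) ⊗ₜ[S] (1 : S) := by
          rw [TensorProduct.smul_tmul, smul_eq_mul, mul_one]
        rw [this, ← Algebra.algebraMap_eq_smul_one, h, TensorProduct.zero_tmul])
      have e' := hI _ (fun i r hr => by
        simp only [LinearMap.mem_ker, LinearMap.toSpanSingleton_apply, smul_eq_mul] at hr ⊢
        rw [← DirectSum.coe_decompose_mul_add_of_right_mem 𝒮 hs, hr]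
        simp) e
      have h1 : (1 : S) ∈ LinearMap.ker (LinearMap.toSpanSingleton S S s) := e' ▸ trivial
      simpa using h1
    intro s hs
    classical
    rw [← DirectSum.sum_support_decompose 𝒮 s]
    refine Finset.sum_eq_zero fun n _ => hhom n _ (SetLike.coe_mem _) ?_
    rw [← coeff_coaction 𝒮 ρ hρ, hs, map_zero]
    rfl
  · have hhom : ∀ n : ℤ, ∀ x : C, ρ x = LaurentPolynomial.C x * LaurentPolynomial.T n →
        x ∈ LinearMap.range (Algebra.linearMap S C) := by
      intro n x hx
      let R := LinearMap.range (Algebra.linearMap S C)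
      have h0 : (R.mkQ 1 : C ⧸ R) = 0 :=
        (Submodule.Quotient.mk_eq_zero R).mpr ⟨1, map_one (algebraMap S C)⟩
      -- The same argument for the class of x modulo the image of S: it dies in C ⊗ (C / R) because
      -- 1 ⊗ x = x ⊗ 1. The ideal {s | sx ∈ R} is homogeneous because x is.
      have e := map_ker_toSpanSingleton_eq_top (C := C) (R.mkQ x) (by
        have := congrArg (R.mkQ.lTensor C)
          ((Algebra.isEpi_iff_forall_one_tmul_eq S C).mp inferInstance x)
        rwa [LinearMap.lTensor_tmul, LinearMap.lTensor_tmul, h0, TensorProduct.tmul_zero] at this)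
      have hmem : ∀ s : S, s ∈ LinearMap.ker (LinearMap.toSpanSingleton S (C ⧸ R) (R.mkQ x)) ↔
          algebraMap S C s * x ∈ R := by
        intro s
        rw [LinearMap.mem_ker, LinearMap.toSpanSingleton_apply, ← map_smul,
          Submodule.mkQ_apply, Submodule.Quotient.mk_eq_zero, Algebra.smul_def]
      have e' := hI _ (fun i r hr => by
        rw [hmem] at hr ⊢
        obtain ⟨s, hs⟩ := hr
        refine ⟨DirectSum.decompose 𝒮 s (i + n), ?_⟩
        rw [Algebra.linearMap_apply] at hs ⊢
        rw [← coeff_coaction 𝒮 ρ hρ, hs, map_mul, hx, ← LaurentPolynomial.single_eq_C_mul_T,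
          AddMonoidAlgebra.coeff_mul_single_eq_coeff_mul i (by
            intro m _
            constructor <;> intro h <;> omega), coeff_coaction 𝒮 ρ hρ]) e
      have h1 := (hmem 1).mp (e' ▸ trivial)
      rwa [map_one, one_mul] at h1
    intro c
    rw [← sum_coeff_coaction 𝒮 ρ hρ c]
    exact (sum_mem fun n _ => hhom n _ (coaction_coeff 𝒮 ρ hρ c n) :
      _ ∈ LinearMap.range (Algebra.linearMap S C))

end FlatEpi

/-! ### Residue homomorphisms of a frame -/

section Residue

universe u

variable {S : Type u} {E : Type*} [CommRing S] [SetLike E S] [AddSubgroupClass E S]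
variable (𝒮 : ℤ → E) [GradedRing 𝒮]

/-- The extension by zero of a homomorphism on the degree zero part that annihilates all products
of homogeneous elements of opposite nonzero degree. -/
def extendZero {K : Type*} [CommRing K] (r : 𝒮 0 →+* K)
    (hr : ∀ n : ℤ, n ≠ 0 → ∀ a ∈ 𝒮 n, ∀ b ∈ 𝒮 (-n), r (DirectSum.decompose 𝒮 (a * b) 0) = 0) :
    S →+* K where
  toFun s := r (DirectSum.decompose 𝒮 s 0)
  map_zero' := by simp
  map_add' a b := by simp [DirectSum.decompose_add]
  map_one' := by
    rw [DirectSum.decompose_one]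
    exact map_one _
  map_mul' a b := by
    induction a using DirectSum.Decomposition.inductionOn 𝒮 with
    | zero => simp
    | add a₁ a₂ h₁ h₂ =>
      rw [add_mul, DirectSum.decompose_add, DirectSum.decompose_add, DirectSum.add_apply,
        DirectSum.add_apply, map_add, map_add, h₁, h₂, add_mul]
    | @homogeneous i a =>
      induction b using DirectSum.Decomposition.inductionOn 𝒮 with
      | zero => simp
      | add a₁ a₂ h₁ h₂ =>
        rw [mul_add, DirectSum.decompose_add, DirectSum.decompose_add, DirectSum.add_apply,
          DirectSum.add_apply, map_add, map_add, h₁, h₂, mul_add]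
      | @homogeneous j b =>
        rw [← map_mul]
        by_cases hi : i = 0
        · subst hi
          congr 1
          ext
          have := DirectSum.coe_decompose_mul_add_of_left_mem 𝒮 a.2 (b := (b : S)) (j := 0)
          rw [zero_add] at this
          have ha : DirectSum.decompose 𝒮 (a : S) 0 = a := by
            rw [DirectSum.decompose_coe, DirectSum.of_eq_same]
          rw [this, ha]
          rfl
        · have h0 : DirectSum.decompose 𝒮 (a : S) 0 = 0 :=
            Subtype.ext (DirectSum.decompose_of_mem_ne 𝒮 a.2 hi)
          rw [h0, zero_mul, map_zero]
          by_cases hj : j = -i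
          · subst hj
            exact hr i hi a a.2 b b.2
          · have : DirectSum.decompose 𝒮 ((a : S) * b) 0 = 0 :=
              Subtype.ext (DirectSum.decompose_of_mem_ne 𝒮 (SetLike.GradedMul.mul_mem a.2 b.2)
                (by omega))
            rw [this, map_zero]

-- Injectivity of τ gives b = tⁿτ(b), so ab = xτ(b) with x = atⁿ in degree 0. Now σ(x) = σ(a)pⁿ lies
-- in the Jacobson radical, and xᵖ ≡ σ(x) modulo p. So xᵖ lies there too, and therefore x does.
variable {𝒮} in
lemma PreFrame.IsFrame.decompose_mul_mem {p : ℕ} {F : PreFrame 𝒮} (hF : F.IsFrame p)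
    (n : ℕ) (hn : 1 ≤ n) (a b : S) (ha : a ∈ 𝒮 n) (hb : b ∈ 𝒮 (-(n : ℤ))) :
    DirectSum.decompose 𝒮 (a * b) 0 ∈ Ideal.jacobson (⊥ : Ideal (𝒮 0)) := by
  obtain ⟨t, ht, hσ⟩ := hF.σ_t
  have htn : (t : S) ^ n ∈ 𝒮 (-(n : ℤ)) := by
    have := SetLike.pow_mem_graded n t.2
    simpa using this
  have hτn : F.τ ((t : S) ^ n) = 1 := by rw [map_pow, ht, one_pow]
  have hb' : b = (t : S) ^ n * (F.τ b : 𝒮 0) := by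
    have hmem : (t : S) ^ n * (F.τ b : 𝒮 0) ∈ 𝒮 (-(n : ℤ)) := by
      have := SetLike.GradedMul.mul_mem htn (F.τ b).2
      rwa [add_zero] at this
    have := (hF.τ_neg_bijective n hn).1 (a₁ := ⟨b, hb⟩) (a₂ := ⟨_, hmem⟩) (by
      simp [hτn, hF.τ_zero])
    exact congrArg Subtype.val this
  have hx : a * (t : S) ^ n ∈ 𝒮 0 := by
    have := SetLike.GradedMul.mul_mem ha htn
    rwa [add_neg_cancel] at this
  let x : 𝒮 0 := ⟨a * (t : S) ^ n, hx⟩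
  have hab : DirectSum.decompose 𝒮 (a * b) 0 = x * F.τ b := by
    have : a * b = ((x * F.τ b : 𝒮 0) : S) := by
      conv_lhs => rw [hb', ← mul_assoc]
      rfl
    rw [this, DirectSum.decompose_coe, DirectSum.of_eq_same]
  rw [hab]
  refine Ideal.mul_mem_right _ _ ?_
  have hσx : F.σ (x : S) ∈ Ideal.jacobson (⊥ : Ideal (𝒮 0)) := by
    change F.σ (a * (t : S) ^ n) ∈ _
    rw [map_mul, map_pow, hσ]
    exact Ideal.mul_mem_left _ _ (Ideal.pow_mem_of_mem _ hF.p_mem_rad n (by omega))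
  have hxp : x ^ p ∈ Ideal.jacobson (⊥ : Ideal (𝒮 0)) := by
    have h₁ : F.σ (x : S) - x ^ p ∈ Ideal.jacobson (⊥ : Ideal (𝒮 0)) :=
      (Ideal.span_singleton_le_iff_mem _).mpr hF.p_mem_rad (hF.σ_frobenius x)
    have := sub_mem hσx h₁
    rwa [sub_sub_cancel] at this
  rw [Ideal.jacobson, Submodule.mem_sInf] at hxp ⊢
  intro m hm
  exact hm.2.isPrime.mem_of_pow_mem p (hxp m hm)

/-- A proper homogeneous ideal in a frame lies in the kernel of a homomorphism to a nontrivial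
ring that vanishes in all nonzero degrees. -/
lemma PreFrame.IsFrame.exists_residueHom {p : ℕ} {F : PreFrame 𝒮}
    (hF : F.IsFrame p) (I : Ideal S) (hI : I.IsHomogeneous 𝒮) (hI' : I ≠ ⊤) :
    ∃ (K : Type u) (_ : CommRing K) (_ : Nontrivial K) (χ : S →+* K), (∀ s ∈ I, χ s = 0) ∧
      ∀ n : ℤ, n ≠ 0 → ∀ s ∈ 𝒮 n, χ s = 0 := by
  let I₀ : Ideal (𝒮 0) := I.comap (SetLike.GradeZero.subring 𝒮).subtype
  have hI₀ : I₀ ≠ ⊤ := by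
    intro h
    have : (1 : 𝒮 0) ∈ I₀ := h ▸ trivial
    exact hI' ((Ideal.eq_top_iff_one I).mpr this)
  obtain ⟨m, hm, hle⟩ := Ideal.exists_le_maximal I₀ hI₀
  have hjac : Ideal.jacobson (⊥ : Ideal (𝒮 0)) ≤ m := sInf_le ⟨bot_le, hm⟩
  refine ⟨𝒮 0 ⧸ m, inferInstance, Ideal.Quotient.nontrivial_iff.mpr hm.ne_top,
    -- Extension by zero is multiplicative because 𝔪 contains the Jacobson radical, hence the
    -- products of opposite nonzero degrees.
    extendZero 𝒮 (Ideal.Quotient.mk m) ?_, fun s hs => ?_, fun n hn s hs => ?_⟩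
  · intro n hn a ha b hb
    refine Ideal.Quotient.eq_zero_iff_mem.mpr (hjac ?_)
    rcases lt_or_gt_of_ne hn with h | h
    · obtain ⟨k, hk⟩ := Int.eq_ofNat_of_zero_le (a := -n) (by omega)
      obtain rfl : n = -(k : ℤ) := by omega
      rw [neg_neg] at hb
      rw [mul_comm]
      exact hF.decompose_mul_mem k (by omega) b a hb ha
    · obtain ⟨k, rfl⟩ := Int.eq_ofNat_of_zero_le h.le
      exact hF.decompose_mul_mem k (by omega) a b ha hb
  · exact Ideal.Quotient.eq_zero_iff_mem.mpr (hle (hI 0 hs))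
  · change Ideal.Quotient.mk m (DirectSum.decompose 𝒮 s 0) = 0
    have h0 : DirectSum.decompose 𝒮 s 0 = 0 := Subtype.ext (DirectSum.decompose_of_mem_ne 𝒮 hs hn)
    rw [h0, map_zero]

end Residue

/-! ### Equivariance as an equality of Laurent points -/

section Twist

variable {W : Type*} [CommRing W] {A : Type*} [CommRing A] [HopfAlgebra W A]
variable {X Y : Type*} [CommRing X] [Algebra W X] [CommRing Y] [Algebra W Y]
variable {μ : A →ₐc[W] W[T;T⁻¹]}

lemma IsMinus.twist {g : WithConv (A →ₐ[W] X)} (hg : IsMinus μ g) : IsMinus μ (twist μ g) := by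
  intro n hn f hf
  rw [twist_apply_of_mem μ g hf, hg n hn f hf, map_zero, zero_mul]

lemma IsUnip.twist {g : WithConv (A →ₐ[W] X)} (hg : IsUnip μ g) : IsUnip μ (twist μ g) := by
  intro n hn f hf
  rw [twist_apply_of_mem μ g hf, hg n hn f hf]
  rcases hn.lt_or_eq with hn | rfl
  · simp [counit_eq_zero μ hn.ne hf]
  · rw [LaurentPolynomial.T_zero, mul_one]
    rfl

variable {S : Type*} [CommRing S] [Algebra W S] (𝒮 : ℤ → Submodule W S) [GradedAlgebra 𝒮]

/-- The coaction `s ↦ ∑ sₙ Tⁿ` defined by a grading. -/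
def gradedCoaction : S →ₐ[W] S[T;T⁻¹] :=
  (DirectSum.toAlgebra W (fun n => 𝒮 n)
    (fun n => (LinearMap.mulRight W (LaurentPolynomial.T n : S[T;T⁻¹])).comp
      ((laurentConst W S).toLinearMap.comp (𝒮 n).subtype))
    (by simp) (fun {i j} a b => by
      simp only [LinearMap.comp_apply, LinearMap.mulRight_apply, AlgHom.toLinearMap_apply,
        Submodule.subtype_apply, SetLike.coe_gMul, map_mul, LaurentPolynomial.T_add]
      ring)).comp (DirectSum.decomposeAlgEquiv 𝒮).toAlgHom

lemma gradedCoaction_of_mem {n : ℤ} {s : S} (hs : s ∈ 𝒮 n) :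
    gradedCoaction 𝒮 s = LaurentPolynomial.C s * LaurentPolynomial.T n := by
  have h : (DirectSum.decomposeAlgEquiv 𝒮).toAlgHom s = DirectSum.of (fun n => 𝒮 n) n ⟨s, hs⟩ :=
    DirectSum.decompose_of_mem _ hs
  rw [gradedCoaction, AlgHom.comp_apply, h]
  exact DirectSum.toAddMonoid_of (fun n =>
    ((LinearMap.mulRight W (LaurentPolynomial.T n : S[T;T⁻¹])).comp
      ((laurentConst W S).toLinearMap.comp (𝒮 n).subtype)).toAddMonoidHom) n ⟨s, hs⟩

lemma mem_of_gradedCoaction_eq {n : ℤ} {s : S}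
    (hs : gradedCoaction 𝒮 s = LaurentPolynomial.C s * LaurentPolynomial.T n) : s ∈ 𝒮 n := by
  have h := coeff_coaction (C := S) 𝒮 (gradedCoaction 𝒮).toRingHom
    (fun n s hs => gradedCoaction_of_mem 𝒮 hs) s n
  change (gradedCoaction 𝒮 s).coeff n = _ at h
  rw [hs, ← LaurentPolynomial.single_eq_C_mul_T, AddMonoidAlgebra.coeff_single,
    Finsupp.single_eq_same] at h
  rw [h]
  exact SetLike.coe_mem _

lemma mem_displayGroup_iff_gradedCoaction {g : WithConv (A →ₐ[W] S)} :
    g ∈ displayGroup μ 𝒮 ↔ toConv ((gradedCoaction 𝒮).comp g.ofConv) = twist μ g := by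
  constructor
  · intro h
    apply WithConv.ext
    refine algHom_ext_of_weights μ fun n f hf => ?_
    rw [twist_apply_of_mem μ g hf]
    exact gradedCoaction_of_mem 𝒮 (h n f hf)
  · intro h n f hf
    apply mem_of_gradedCoaction_eq
    rw [← twist_apply_of_mem μ g hf, ← h]
    rfl

/-- If an equivariant point is a product of points of `P⁻` and `U⁺`, then the factors are
equivariant. -/
lemma mem_displayGroup_of_mul_mem {q h : WithConv (A →ₐ[W] S)} (hq : IsMinus μ q)
    (hh : IsUnip μ h) (hqh : q * h ∈ displayGroup μ 𝒮) :
    q ∈ displayGroup μ 𝒮 ∧ h ∈ displayGroup μ 𝒮 := by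
  simp only [mem_displayGroup_iff_gradedCoaction] at hqh ⊢
  rw [comp_mul, twist_mul] at hqh
  -- The coaction and the twist give two factorizations of the same point over S[T, T⁻¹]; uniqueness
  -- identifies the factors.
  exact eq_of_mul_eq_mul (hq.comp _) hq.twist (hh.comp _) hh.twist hqh

end Twist

/-! ### Pulling P⁻ × U⁺ back along a point of G -/

section Pullback

variable {W : Type*} [CommRing W] {A : Type*} [CommRing A] [HopfAlgebra W A]
variable (μ : A →ₐc[W] W[T;T⁻¹])
variable {S : Type*} [CommRing S] [Algebra W S] [Algebra A S] [IsScalarTower W A S]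
variable {X : Type*} [CommRing X] [Algebra W X]

variable (W A S) in
/-- The point of `G` defined by an `A`-algebra. -/
def structurePoint : WithConv (A →ₐ[W] S) := toConv (IsScalarTower.toAlgHom W A S)

variable (S) in
/-- The inclusion of the coordinate ring of `P⁻ × U⁺` into its pullback to `S`. -/
def pullbackIncl : BigCell μ →ₐ[W] S ⊗[A] BigCell μ :=
  (Algebra.TensorProduct.includeRight : BigCell μ →ₐ[A] S ⊗[A] BigCell μ).restrictScalars W

lemma pullbackIncl_algebraMap (a : A) :
    pullbackIncl μ S (algebraMap A (BigCell μ) a) =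
      algebraMap S (S ⊗[A] BigCell μ) (algebraMap A S a) := by
  change (Algebra.TensorProduct.includeRight : BigCell μ →ₐ[A] S ⊗[A] BigCell μ) _ = _
  rw [AlgHom.commutes, IsScalarTower.algebraMap_apply A S (S ⊗[A] BigCell μ)]

/-- The points of the pullback are the factorizations of the given point. -/
lemma exists_pullback_lift (χ : S →ₐ[W] X) {q h : WithConv (A →ₐ[W] X)} (hq : IsMinus μ q)
    (hh : IsUnip μ h) (e : q * h = toConv (χ.comp (structurePoint W A S).ofConv)) :
    ∃ Φ : S ⊗[A] BigCell μ →+* X, ∀ s, Φ (algebraMap S _ s) = χ s := by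
  obtain ⟨φ, rfl, rfl⟩ := BigCell.exists_lift hq hh
  let _ : Algebra A X := (χ.toRingHom.comp (algebraMap A S)).toAlgebra
  let χ' : S →ₐ[A] X := { χ with commutes' := fun _ => rfl }
  let φ' : BigCell μ →ₐ[A] X :=
    { φ with
      commutes' := fun a => (BigCell.apply_algebraMap φ a).trans
        (congrArg (fun g => g.ofConv a) e) }
  refine ⟨(Algebra.TensorProduct.lift χ' φ' fun _ _ => Commute.all _ _).toRingHom, fun s => ?_⟩
  change Algebra.TensorProduct.lift χ' φ' _ (s ⊗ₜ[A] 1) = χ s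
  rw [Algebra.TensorProduct.lift_tmul, map_one, mul_one]
  rfl

lemma pullback_isEpi : Algebra.IsEpi S (S ⊗[A] BigCell μ) := by
  rw [Algebra.isEpi_iff_forall_one_tmul_eq]
  let C := S ⊗[A] BigCell μ
  let l : C →ₐ[S] C ⊗[S] C := Algebra.TensorProduct.includeLeft
  let r : C →ₐ[S] C ⊗[S] C := Algebra.TensorProduct.includeRight
  have hB : (l.restrictScalars W).comp (pullbackIncl μ S) =
      (r.restrictScalars W).comp (pullbackIncl μ S) := BigCell.algHom_ext fun a => by
    have h := pullbackIncl_algebraMap (S := S) μ a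
    exact (congrArg l h).trans ((l.commutes _).trans
      ((r.commutes _).symm.trans (congrArg r h).symm))
  have hlr : l = r := by
    refine Algebra.TensorProduct.ext (Subsingleton.elim _ _) ?_
    ext b
    exact congrArg (fun φ => φ b) hB
  intro c
  exact (congrArg (fun φ => φ c) hlr).symm

end Pullback

/-! ### The decomposition over a frame -/

section Main

variable {W : Type*} [CommRing W] {A : Type*} [CommRing A] [HopfAlgebra W A]
variable (μ : A →ₐc[W] W[T;T⁻¹])
variable {S : Type*} [CommRing S] [Algebra W S] (𝒮 : ℤ → Submodule W S) [GradedAlgebra 𝒮]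

lemma pullback_bijective [IsNoetherianRing W] [Algebra.Smooth W A] [Algebra A S]
    [IsScalarTower W A S] {p : ℕ} {F : PreFrame 𝒮} (hF : F.IsFrame p)
    (hg : structurePoint W A S ∈ displayGroup μ 𝒮) :
    Function.Bijective (algebraMap S (S ⊗[A] BigCell μ)) := by
  let C := S ⊗[A] BigCell μ
  have : Algebra.IsEpi S C := pullback_isEpi μ
  let ι : S →ₐ[W] C := Algebra.TensorProduct.includeLeft
  let q : WithConv (A →ₐ[W] C) := toConv ((pullbackIncl μ S).comp (BigCell.minusPoint μ).ofConv)
  let h : WithConv (A →ₐ[W] C) := toConv ((pullbackIncl μ S).comp (BigCell.unipPoint μ).ofConv)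
  have hq : IsMinus μ q := (BigCell.isMinus_minusPoint μ).comp _
  have hh : IsUnip μ h := (BigCell.isUnip_unipPoint μ).comp _
  have hqh : q * h = toConv (ι.comp (structurePoint W A S).ofConv) := by
    ext a
    exact (BigCell.apply_algebraMap (pullbackIncl μ S) a).symm.trans (pullbackIncl_algebraMap μ a)
  -- The coaction on C: equivariance of the structure point says that the twists of the universal
  -- factors multiply to its image under the coaction of S.
  obtain ⟨ρ, hρ⟩ := exists_pullback_lift (S := S) μ
    ((AddMonoidAlgebra.mapAlgHom ℤ ι).comp (gradedCoaction 𝒮)) hq.twist hh.twist (by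
      rw [← twist_mul, hqh]
      apply WithConv.ext
      refine algHom_ext_of_weights μ fun n f hf => ?_
      rw [twist_apply_of_mem μ _ hf]
      change _ = AddMonoidAlgebra.mapAlgHom ℤ ι (gradedCoaction 𝒮
        ((structurePoint W A S).ofConv f))
      rw [gradedCoaction_of_mem 𝒮 (hg n f hf), ← LaurentPolynomial.single_eq_C_mul_T,
        ← LaurentPolynomial.single_eq_C_mul_T]
      exact (AddMonoidAlgebra.map_single (ι : S →+ C) _ _).symm)
  refine bijective_of_flat_of_isEpi 𝒮 ρ (fun n s hs => ?_) (fun I hI hmap => ?_)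
  · rw [hρ, AlgHom.comp_apply, gradedCoaction_of_mem 𝒮 hs, ← LaurentPolynomial.single_eq_C_mul_T,
      ← LaurentPolynomial.single_eq_C_mul_T]
    exact AddMonoidAlgebra.map_single _ _ _
  · by_contra hI'
    obtain ⟨K, _, _, χ, hχI, hχ⟩ := hF.exists_residueHom 𝒮 I hI hI'
    let _ : Algebra W K := (χ.comp (algebraMap W S)).toAlgebra
    let χ' : S →ₐ[W] K := { χ with commutes' := fun _ => rfl }
    -- Since χ kills nonzero degrees, the structure point becomes a point of P⁻ and factors with
    -- trivial U⁺ part. So χ extends to C, which is impossible if IC = C.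
    obtain ⟨Φ, hΦ⟩ := exists_pullback_lift (S := S) μ χ'
      (q := toConv (χ'.comp (structurePoint W A S).ofConv)) (h := 1)
      (fun n hn f hf => hχ n hn.ne' _ (hg n f hf)) (isUnip_one μ) (mul_one _)
    have hle : I.map (algebraMap S C) ≤ RingHom.ker Φ := by
      rw [Ideal.map_le_iff_le_comap]
      intro s hs
      rw [Ideal.mem_comap, RingHom.mem_ker, hΦ]
      exact hχI s hs
    rw [hmap] at hle
    have h1 : Φ 1 = 0 := hle trivial
    rw [map_one] at h1
    exact one_ne_zero h1

/-- Equivariant points of `G` with values in a frame decompose as products of points of `P⁻`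
and `U⁺`. -/
lemma exists_mul_eq_of_mem_displayGroup [IsNoetherianRing W] [Algebra.Smooth W A] {p : ℕ}
    {F : PreFrame 𝒮} (hF : F.IsFrame p) {g : WithConv (A →ₐ[W] S)} (hg : g ∈ displayGroup μ 𝒮) :
    ∃ q h : WithConv (A →ₐ[W] S), IsMinus μ q ∧ IsUnip μ h ∧ q * h = g := by
  let _ : Algebra A S := g.ofConv.toRingHom.toAlgebra
  have : IsScalarTower W A S := IsScalarTower.of_algebraMap_eq fun w => (g.ofConv.commutes w).symm
  have hbij := pullback_bijective μ 𝒮 hF (show structurePoint W A S ∈ displayGroup μ 𝒮 from hg)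
  let e : S ≃ₐ[S] S ⊗[A] BigCell μ := AlgEquiv.ofBijective (Algebra.ofId S _) hbij
  -- The inverse of S → C transports the universal factorization back to S.
  let φ : BigCell μ →ₐ[W] S := (e.symm.toAlgHom.restrictScalars W).comp (pullbackIncl μ S)
  refine ⟨_, _, (BigCell.isMinus_minusPoint μ).comp φ, (BigCell.isUnip_unipPoint μ).comp φ, ?_⟩
  ext a
  rw [← BigCell.apply_algebraMap]
  change e.symm (pullbackIncl μ S _) = g.ofConv a
  rw [pullbackIncl_algebraMap, AlgEquiv.commutes]
  rfl

/-- The decomposition `G(S)_μ = P⁻(S)_μ × U⁺(S)_μ` for a frame. -/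
theorem bijOn_mul [IsNoetherianRing W] [Algebra.Smooth W A] {p : ℕ} {F : PreFrame 𝒮}
    (hF : F.IsFrame p) :
    Set.BijOn (fun x : WithConv (A →ₐ[W] S) × WithConv (A →ₐ[W] S) => x.1 * x.2)
      (PMinus μ 𝒮 ×ˢ UPlus μ 𝒮) (displayGroup μ 𝒮) := by
  refine ⟨?_, ?_, ?_⟩
  · rintro ⟨q, h⟩ ⟨hq, hh⟩
    exact mul_mem_displayGroup μ 𝒮 hq.1 hh.1
  · rintro ⟨q, h⟩ ⟨hq, hh⟩ ⟨q', h'⟩ ⟨hq', hh'⟩ e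
    exact Prod.ext_iff.mpr (eq_of_mul_eq_mul ((isMinus_iff μ q).mpr hq.2)
      ((isMinus_iff μ q').mpr hq'.2) ((isUnip_iff μ h).mpr hh.2) ((isUnip_iff μ h').mpr hh'.2) e)
  · intro g hg
    obtain ⟨q, h, hq, hh, rfl⟩ := exists_mul_eq_of_mem_displayGroup μ 𝒮 hF hg
    obtain ⟨hq', hh'⟩ := mem_displayGroup_of_mul_mem 𝒮 hq hh hg
    exact ⟨(q, h), ⟨⟨hq', (isMinus_iff μ q).mp hq⟩, ⟨hh', (isUnip_iff μ h).mp hh⟩⟩, rfl⟩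

end Main

end GDisplay

end

theorem proposition5 (p : ℕ) [Fact p.Prime]
    (k : Type*) [Field k] [Finite k] [CharP k p]
    (A' : Type*) [CommRing A'] [HopfAlgebra ℤ_[p] A'] [Algebra.Smooth ℤ_[p] A']
    (μ : (WittVector p k ⊗[ℤ_[p]] A') →ₐc[WittVector p k] (WittVector p k)[T;T⁻¹])
    (S : Type*) [CommRing S] [Algebra (WittVector p k) S]
    (𝒮 : ℤ → Submodule (WittVector p k) S) [GradedAlgebra 𝒮]
    (F : GDisplay.PreFrame 𝒮) (hF : F.IsFrameOverWitt p) :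
    Set.BijOn
      (fun x : WithConv ((WittVector p k ⊗[ℤ_[p]] A') →ₐ[WittVector p k] S) ×
          WithConv ((WittVector p k ⊗[ℤ_[p]] A') →ₐ[WittVector p k] S) => x.1 * x.2)
      (GDisplay.PMinus μ 𝒮 ×ˢ GDisplay.UPlus μ 𝒮)
      (GDisplay.displayGroup μ 𝒮) :=
  GDisplay.bijOn_mul μ 𝒮 hF.toIsFrame
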